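/- Conventions. Let $n\in\mathbb N$ and, for $i\in\{1,\dots,n\}$, let $\mathfrak A_i$ be a unital C$^*$-algebra, $\pi_i:\mathfrak A_i\to\mathcal B(\mathcal H_i)$ a faithful unital representation on a complex Hilbert space, and $\xi_i\in\mathcal H_i$ a unit vector. Put $\mathcal H_i^0=\mathcal H_i\ominus\mathbb C\xi_i$ and $$\ast_{i=1}^n(\mathcal H_i,\xi_i)=\mathbb C\xi_0\oplus\bigoplus_{m\ge1}\ \bigoplus_{\substack{i_1,\dots,i_m\\ i_k\ne i_{k+1}}}\mathcal H^0_{i_1}\otimes\cdots\otimes\mathcal H^0_{i_m},$$ with $\xi_0$ a unit vector, and let $\mathcal H(i)$ be the subspace obtained by keeping $\mathbb C\xi_0$ and only the summands with $i_1\ne i$. Let $U_i:\mathcal H_i\otimes\mathcal H(i)\to\ast_{j}(\mathcal H_j,\xi_j)$ be the canonical unitary (which identifies $\xi_i\otimes\zeta$ with $\zeta$ for $\zeta\in\mathcal H(i)$, $\eta\otimes\xi_0$ with $\eta$ for $\eta\in\mathcal H_i^0$, and $\eta\otimes(\zeta_1\otimes\cdots\otimes\zeta_m)$ with $\eta\otimes\zeta_1\otimes\cdots\otimes\zeta_m$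 for $\eta\in\mathcal H_i^0$ and $\zeta_1\otimes\cdots\otimes\zeta_m\in\mathcal H(i)$). Each $\mathfrak A_i$ acts on $\ast_{j}(\mathcal H_j,\xi_j)$ by $A\mapsto U_i(\pi_i(A)\otimes I)U_i^*$, and the reduced free product $\ast_{i=1}^n(\mathfrak A_i,\pi_i,\xi_i)$ is the C$^*$-algebra of operators on $\ast_{j}(\mathcal H_j,\xi_j)$ generated by these copies of $\mathfrak A_1,\dots,\mathfrak A_n$. We identify $\mathfrak A_i$ with its copy. The representations $\pi_i$ are not assumed to be GNS representations, and $\xi_i$ need not be cyclic. Theorem. For $i\in\{1,\dots,n\}$ let $\mathfrak A'_i$ and $\mathfrak A_i$ be unital C$^*$-algebras, let $\pi'_i:\mathfrak A'_i\to\mathcal B(\mathcal H'_i)$ and $\pi_i:\mathfrak A_i\to\mathcal B(\mathcal H_i)$ be faithful unital representations, and let $\xi'_i\in\mathcal H'_i$ and $\xi_i\in\mathcal H_i$ be unit vectors. Suppose that $\varphi_i:\mathfrak A'_i\to\mathfrak A_i$ are unital completely positive maps such that $$\langle\pi_i(\varphi_i(A))\xi_i,\xi_i\rangle_{\mathcal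 H_i}=\langle\pi'_i(A)\xi'_i,\xi'_i\rangle_{\mathcal H'_i}\qquad\text{for all }A\in\mathfrak A'_i .$$ Then there exists a unital completely positive map $$\Phi:\ast_{i=1}^n(\mathfrak A'_i,\pi'_i,\xi'_i)\to\ast_{i=1}^n(\mathfrak A_i,\pi_i,\xi_i)$$ such that $\Phi(A)=\varphi_i(A)$ for all $i$ and all $A\in\mathfrak A'_i$, and $$\Phi(A_1A_2\cdots A_m)=\Phi(A_1)\Phi(A_2)\cdots\Phi(A_m)$$ whenever $m\ge1$, $A_j\in\mathfrak A'_{i_j}$ and $\langle\pi'_{i_j}(A_j)\xi'_{i_j},\xi'_{i_j}\rangle=0$ for all $j\in\{1,\dots,m\}$, and $i_j\ne i_{j+1}$ for all $j\in\{1,\dots,m-1\}$. -/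

import Mathlib

open scoped TensorProduct InnerProductSpace CStarAlgebra

noncomputable section

namespace FreeProd

universe u v

/-! ### Hilbert space tensor products -/

/-- The Hilbert space tensor product: the completion of the algebraic tensor product with respect
to the inner product `⟪x ⊗ y, x' ⊗ y'⟫ = ⟪x, x'⟫ * ⟪y, y'⟫`. -/
abbrev HilbertTensor (E F : Type*) [NormedAddCommGroup E] [InnerProductSpace ℂ E]
    [NormedAddCommGroup F] [InnerProductSpace ℂ F] : Type _ :=
  UniformSpace.Completion (E ⊗[ℂ] F)

section HilbertTensor

variable {E F E' F' : Type*}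
  [NormedAddCommGroup E] [InnerProductSpace ℂ E] [NormedAddCommGroup F] [InnerProductSpace ℂ F]
  [NormedAddCommGroup E'] [InnerProductSpace ℂ E']
  [NormedAddCommGroup F'] [InnerProductSpace ℂ F']

/-- The elementary tensor `x ⊗ y` in the Hilbert space tensor product. -/
def htmul (x : E) (y : F) : HilbertTensor E F := ((x ⊗ₜ[ℂ] y : E ⊗[ℂ] F) : HilbertTensor E F)

theorem inner_htmul (x x' : E) (y y' : F) :
    ⟪htmul x y, htmul x' y'⟫_ℂ = ⟪x, x'⟫_ℂ * ⟪y, y'⟫_ℂ := by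
  simp [htmul, UniformSpace.Completion.inner_coe]

theorem htmul_add (x : E) (y y' : F) : htmul x (y + y') = htmul x y + htmul x y' := by
  simp [htmul, TensorProduct.tmul_add, UniformSpace.Completion.coe_add]

theorem add_htmul (x x' : E) (y : F) : htmul (x + x') y = htmul x y + htmul x' y := by
  simp [htmul, TensorProduct.add_tmul, UniformSpace.Completion.coe_add]

theorem htmul_smul (c : ℂ) (x : E) (y : F) : htmul x (c • y) = c • htmul x y := by
  simp [htmul, TensorProduct.tmul_smul, UniformSpace.Completion.coe_smul]

theorem smul_htmul (c : ℂ) (x : E) (y : F) : htmul (c • x) y = c • htmul x y := by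
  rw [htmul, ← TensorProduct.smul_tmul', UniformSpace.Completion.coe_smul, htmul]

theorem norm_htmul (x : E) (y : F) : ‖htmul x y‖ = ‖x‖ * ‖y‖ := by
  simp [htmul, UniformSpace.Completion.norm_coe]

theorem continuous_htmul (x : E) : Continuous fun y : F => htmul x y :=
  (UniformSpace.Completion.continuous_coe _).comp
    (TensorProduct.mkL ℂ E F x).continuous

/-- A closed submodule containing all elementary tensors is everything. -/
theorem mem_of_htmul_mem (S : Submodule ℂ (HilbertTensor E F)) (hS : IsClosed (S : Set (HilbertTensor E F)))
    (h : ∀ x y, htmul x y ∈ S) (z : HilbertTensor E F) : z ∈ S := by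
  induction z using UniformSpace.Completion.induction_on with
  | hp => exact hS
  | ih z =>
    induction z using TensorProduct.induction_on with
    | zero => simp [UniformSpace.Completion.coe_zero]
    | tmul x y => exact h x y
    | add a b ha hb => rw [UniformSpace.Completion.coe_add]; exact S.add_mem ha hb

/-- The isometry `y ↦ ξ ⊗ y` given by a unit vector `ξ`. -/
def htmulLeft (ξ : E) (hξ : ‖ξ‖ = 1) : F →ₗᵢ[ℂ] HilbertTensor E F where
  toFun y := htmul ξ y
  map_add' := htmul_add ξ
  map_smul' c y := htmul_smul c ξ y
  norm_map' y := by simp [norm_htmul, hξ]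

/-- The linear map `y ↦ x ⊗ y`. -/
def htmulLinear (x : E) : F →ₗ[ℂ] HilbertTensor E F where
  toFun y := htmul x y
  map_add' := htmul_add x
  map_smul' c y := htmul_smul c x y

/-- The tensor product of two isometries. -/
def htmulMap (f : E →ₗᵢ[ℂ] E') (g : F →ₗᵢ[ℂ] F') :
    HilbertTensor E F →ₗᵢ[ℂ] HilbertTensor E' F' where
  toLinearMap := ((TensorProduct.mapL f.toContinuousLinearMap
    g.toContinuousLinearMap).completion : HilbertTensor E F →L[ℂ] HilbertTensor E' F').toLinearMap
  norm_map' z := by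
    induction z using UniformSpace.Completion.induction_on with
    | hp => exact isClosed_eq (ContinuousLinearMap.continuous _).norm continuous_norm
    | ih z =>
      simp [UniformSpace.Completion.norm_coe]

theorem htmulMap_htmul (f : E →ₗᵢ[ℂ] E') (g : F →ₗᵢ[ℂ] F') (x : E) (y : F) :
    htmulMap f g (htmul x y) = htmul (f x) (g y) := by
  simp [htmulMap, htmul]

/-- `T ↦ T ⊗ 1`. -/
def ampliationFun (T : E →L[ℂ] E) : HilbertTensor E F →L[ℂ] HilbertTensor E F :=
  (T.rTensor F).completion

theorem ampliationFun_htmul (T : E →L[ℂ] E) (x : E) (y : F) :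
    ampliationFun T (htmul x y) = htmul (T x) y := by
  simp [ampliationFun, htmul]

theorem htmul_ext {S T : HilbertTensor E F →L[ℂ] HilbertTensor E' F'}
    (h : ∀ x y, S (htmul x y) = T (htmul x y)) : S = T := by
  ext z
  exact mem_of_htmul_mem (LinearMap.eqLocus S.toLinearMap T.toLinearMap)
    (isClosed_eq S.continuous T.continuous) h z

/-- The ampliation `T ↦ T ⊗ 1`, a unital *-homomorphism `B(E) → B(E ⊗ F)`. -/
def ampliation [CompleteSpace E] : (E →L[ℂ] E) →⋆ₐ[ℂ] (HilbertTensor E F →L[ℂ] HilbertTensor E F) where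
  toFun := ampliationFun
  map_one' := htmul_ext fun x y => by simp [ampliationFun_htmul]
  map_mul' S T := htmul_ext fun x y => by simp [ampliationFun_htmul]
  map_zero' := htmul_ext fun x y => by
    rw [ampliationFun_htmul, zero_apply, zero_apply,
      ← zero_smul ℂ (0 : E), smul_htmul, zero_smul]
  map_add' S T := htmul_ext fun x y => by simp [ampliationFun_htmul, add_htmul]
  commutes' c := htmul_ext fun x y => by
    simp [ampliationFun_htmul, Algebra.algebraMap_eq_smul_one, smul_htmul]
  map_star' T := by
    rw [ContinuousLinearMap.star_eq_adjoint, ContinuousLinearMap.star_eq_adjoint,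
      ContinuousLinearMap.eq_adjoint_iff]
    intro a b
    refine mem_of_htmul_mem
      { carrier := {a | ⟪ampliationFun (ContinuousLinearMap.adjoint T) a, b⟫_ℂ
          = ⟪a, ampliationFun T b⟫_ℂ}
        zero_mem' := by simp
        add_mem' := fun {p q} hp hq => by
          simp only [Set.mem_ofPred_eq, map_add, inner_add_left] at *; rw [hp, hq]
        smul_mem' := fun c p hp => by
          simp only [Set.mem_ofPred_eq, map_smul, inner_smul_left] at *; rw [hp] }
      (isClosed_eq (by fun_prop) (by fun_prop)) (fun x y => ?_) a
    refine mem_of_htmul_mem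
      { carrier := {b | ⟪ampliationFun (ContinuousLinearMap.adjoint T) (htmul x y), b⟫_ℂ
          = ⟪htmul x y, ampliationFun T b⟫_ℂ}
        zero_mem' := by simp
        add_mem' := fun {p q} hp hq => by
          simp only [Set.mem_ofPred_eq, map_add, inner_add_right] at *; rw [hp, hq]
        smul_mem' := fun c p hp => by
          simp only [Set.mem_ofPred_eq, map_smul, inner_smul_right] at *; rw [hp] }
      (isClosed_eq (by fun_prop) (by fun_prop)) (fun x' y' => ?_) b
    simp [ampliationFun_htmul, inner_htmul, ContinuousLinearMap.adjoint_inner_left]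

theorem ampliation_htmul [CompleteSpace E] (T : E →L[ℂ] E) (x : E) (y : F) :
    ampliation T (htmul x y) = htmul (T x) y := ampliationFun_htmul T x y

end HilbertTensor

/-- A closed *-subalgebra of a C*-algebra, with the order inherited from the ambient algebra, is
again a C*-algebra with its usual order. -/
instance instStarOrderedRingStarSubalgebra {B : Type*} [CStarAlgebra B] [PartialOrder B]
    [StarOrderedRing B] (S : StarSubalgebra ℂ B) [hS : IsClosed (S : Set B)] :
    StarOrderedRing S := by
  refine StarOrderedRing.of_nonneg_iff' (fun {x y} h z => add_le_add_right (α := B) h z) fun x => ?_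
  constructor
  · intro hx
    have hx' : (0 : B) ≤ (x : B) := hx
    have hsa : IsSelfAdjoint x := Subtype.ext (IsSelfAdjoint.of_nonneg hx').star_eq
    have hsp : SpectrumRestricts x ContinuousMap.realToNNReal := by
      rw [SpectrumRestricts.nnreal_iff]
      intro r hr
      refine spectrum_nonneg_of_nonneg (𝕜 := ℝ) hx' ?_
      rw [← spectrum.preimage_algebraMap ℂ, Set.mem_preimage] at hr ⊢
      rwa [← StarSubalgebra.spectrum_eq]
    obtain ⟨s, hs, -, h⟩ := CFC.exists_sqrt_of_isSelfAdjoint_of_quasispectrumRestricts hsa hsp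
    exact ⟨s, by rw [hs.star_eq, h]⟩
  · rintro ⟨s, rfl⟩
    exact star_mul_self_nonneg (s : B)

/-! ### Free products of Hilbert spaces with unit vectors -/

/-- A bundled complex Hilbert space. -/
structure Hilb : Type (v + 1) where
  carrier : Type v
  [normed : NormedAddCommGroup carrier]
  [inner : InnerProductSpace ℂ carrier]
  [complete : CompleteSpace carrier]

attribute [instance] Hilb.normed Hilb.inner Hilb.complete

/-- The words `i₁ i₂ ⋯ iₙ` (`n ≥ 0`) in the index set with `iₖ ≠ iₖ₊₁`. -/
abbrev Word (ι : Type u) : Type u := {l : List ι // l.IsChain (· ≠ ·)}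

/-- The words that do not begin with the letter `i`. -/
abbrev WordNot {ι : Type u} (i : ι) : Type u := {w : Word ι // w.1.head? ≠ some i}

section

variable {ι : Type u} {H : ι → Type v}
  [∀ i, NormedAddCommGroup (H i)] [∀ i, InnerProductSpace ℂ (H i)]

/-- The Hilbert space `H⁰_{i₁} ⊗ ⋯ ⊗ H⁰_{iₙ}` attached to a word, where `H⁰_i` is the orthogonal
complement of `ξ i` in `H i`. The empty word gives a one-dimensional space. -/
def wordHilb (ξ : ∀ i, H i) : List ι → Hilb.{v}
  | [] => ⟨EuclideanSpace ℂ PUnit.{v + 1}⟩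
  | i :: l => ⟨HilbertTensor (ℂ ∙ ξ i)ᗮ (wordHilb ξ l).carrier⟩

abbrev WordSpace (ξ : ∀ i, H i) (l : List ι) : Type v := (wordHilb ξ l).carrier

/-- The identification of the space of the word `i l` with `H⁰_i ⊗ (space of l)`. -/
def wordCons (ξ : ∀ i, H i) (i : ι) (l : List ι) :
    HilbertTensor (ℂ ∙ ξ i)ᗮ (WordSpace ξ l) ≃ₗᵢ[ℂ] WordSpace ξ (i :: l) :=
  LinearIsometryEquiv.refl ℂ (HilbertTensor (ℂ ∙ ξ i)ᗮ (WordSpace ξ l))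

/-- The free product of the Hilbert spaces `H i` with unit vectors `ξ i`: the Hilbert space direct
sum of `H⁰_{i₁} ⊗ ⋯ ⊗ H⁰_{iₙ}` over all words `i₁ ⋯ iₙ`, `n ≥ 0`, with `iₖ ≠ iₖ₊₁`. -/
abbrev FreeHilbert (ξ : ∀ i, H i) : Type (max u v) := lp (fun w : Word ι => WordSpace ξ w.1) 2

/-- The Hilbert space direct sum over those words that do not begin with `i`. -/
abbrev FreeHilbertNot (ξ : ∀ i, H i) (i : ι) : Type (max u v) :=
  lp (fun w : WordNot i => WordSpace ξ w.1.1) 2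

/-- The word `i w`. -/
abbrev WordNot.cons {i : ι} (w : WordNot i) : Word ι :=
  ⟨i :: w.1.1, List.isChain_cons.2
    ⟨fun _ hy h => w.2 (by subst h; exact Option.mem_def.1 hy), w.1.2⟩⟩

/-- The tail of a word beginning with `i`, as a word that does not begin with `i`. -/
def tailNot (i : ι) (l : List ι) (h : (i :: l).IsChain (· ≠ ·)) : WordNot i :=
  ⟨⟨l, (List.isChain_cons.1 h).2⟩, fun hl => (List.isChain_cons.1 h).1 i hl rfl⟩

variable [DecidableEq ι]

/-- The inclusion of a summand of a Hilbert space direct sum. -/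
def lpInclusion {κ : Type*} [DecidableEq κ] {G : κ → Type*} [∀ k, NormedAddCommGroup (G k)]
    [∀ k, InnerProductSpace ℂ (G k)] (k : κ) : G k →ₗᵢ[ℂ] lp G 2 where
  toLinearMap := lp.lsingle 2 k
  norm_map' x := lp.norm_single (by norm_num) k x

theorem lpInclusion_orthogonal {κ : Type*} [DecidableEq κ] {G : κ → Type*}
    [∀ k, NormedAddCommGroup (G k)] [∀ k, InnerProductSpace ℂ (G k)] {k k' : κ} (h : k ≠ k')
    (x : G k) (y : G k') : ⟪lpInclusion k x, lpInclusion k' y⟫_ℂ = 0 := by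
  refine (lp.inner_single_left (𝕜 := ℂ) k x _).trans ?_
  change ⟪x, lp.single 2 k' y k⟫_ℂ = 0
  rw [lp.single_apply_ne _ _ _ h, inner_zero_right]

/-- The restriction of `U_i*` to the summand of a word `w`, where
`U_i : H_i ⊗ H(i) → *_j H_j` is the canonical unitary.
If `w` does not begin with `i`, this is `ζ ↦ ξ_i ⊗ ζ ∈ ℂ ξ_i ⊗ H(i)`; if `w = i w'`, it is the
inclusion `H⁰_i ⊗ (H⁰_{w'}) → H_i ⊗ H(i)`. -/
def headEmb (ξ : ∀ i, H i) (hξ : ∀ i, ‖ξ i‖ = 1) (i : ι) :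
    ∀ w : Word ι, WordSpace ξ w.1 →ₗᵢ[ℂ] HilbertTensor (H i) (FreeHilbertNot ξ i)
  | ⟨[], hw⟩ =>
      (htmulLeft (ξ i) (hξ i)).comp
        (lpInclusion (G := fun w : WordNot i => WordSpace ξ w.1.1) ⟨⟨[], hw⟩, by simp⟩)
  | ⟨j :: l, hw⟩ =>
      if h : j = i then by
        subst h
        exact (htmulMap (ℂ ∙ ξ j)ᗮ.subtypeₗᵢ
          (lpInclusion (G := fun w : WordNot j => WordSpace ξ w.1.1) (tailNot j l hw))).comp
            (wordCons ξ j l).symm.toLinearIsometry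
      else
        (htmulLeft (ξ i) (hξ i)).comp
          (lpInclusion (G := fun w : WordNot i => WordSpace ξ w.1.1)
            ⟨⟨j :: l, hw⟩, by simpa using h⟩)

theorem headEmb_not (ξ : ∀ i, H i) (hξ : ∀ i, ‖ξ i‖ = 1) (i : ι) (w : WordNot i)
    (x : WordSpace ξ w.1.1) :
    headEmb ξ hξ i w.1 x = htmul (ξ i)
      (lpInclusion (G := fun w : WordNot i => WordSpace ξ w.1.1) w x) := by
  obtain ⟨⟨l, hl⟩, hw⟩ := w
  cases l with
  | nil => rfl
  | cons j l =>
    have h : ¬ j = i := by simpa using hw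
    simp only [headEmb, dif_neg h]
    rfl

theorem headEmb_cons (ξ : ∀ i, H i) (hξ : ∀ i, ‖ξ i‖ = 1) (i : ι) (w : WordNot i)
    (x : (ℂ ∙ ξ i)ᗮ) (y : WordSpace ξ w.1.1) :
    headEmb ξ hξ i w.cons (wordCons ξ i w.1.1 (htmul x y)) = htmul (x : H i)
      (lpInclusion (G := fun w : WordNot i => WordSpace ξ w.1.1) w y) := by
  obtain ⟨⟨l, hl⟩, hw⟩ := w
  have h : headEmb ξ hξ i (WordNot.cons ⟨⟨l, hl⟩, hw⟩) =
      (htmulMap (ℂ ∙ ξ i)ᗮ.subtypeₗᵢ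
        (lpInclusion (G := fun w : WordNot i => WordSpace ξ w.1.1) ⟨⟨l, hl⟩, hw⟩)).comp
          (wordCons ξ i l).symm.toLinearIsometry := dif_pos rfl
  rw [h]
  refine Eq.trans ?_ (htmulMap_htmul (ℂ ∙ ξ i)ᗮ.subtypeₗᵢ
    (lpInclusion (G := fun w : WordNot i => WordSpace ξ w.1.1) ⟨⟨l, hl⟩, hw⟩) x y)
  exact congrArg _ ((wordCons ξ i l).symm_apply_apply _)

theorem word_cases (i : ι) (w : Word ι) :
    (∃ w' : WordNot i, w = w'.1) ∨ (∃ w' : WordNot i, w = w'.cons) := by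
  obtain ⟨l, hl⟩ := w
  by_cases h : l.head? = some i
  · right
    cases l with
    | nil => simp at h
    | cons j l =>
      obtain rfl : j = i := by simpa using h
      exact ⟨tailNot j l hl, rfl⟩
  · exact .inl ⟨⟨⟨l, hl⟩, h⟩, rfl⟩

theorem headEmb_orthogonal (ξ : ∀ i, H i) (hξ : ∀ i, ‖ξ i‖ = 1) (i : ι) :
    OrthogonalFamily ℂ (fun w : Word ι => WordSpace ξ w.1) (headEmb ξ hξ i) := by
  have key : ∀ w w' : WordNot i, w ≠ w' → ∀ x y,
      ⟪lpInclusion (G := fun w : WordNot i => WordSpace ξ w.1.1) w x,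
        lpInclusion (G := fun w : WordNot i => WordSpace ξ w.1.1) w' y⟫_ℂ = 0 := by
    exact fun w w' hne x y => 
      lpInclusion_orthogonal (G := fun w : WordNot i => WordSpace ξ w.1.1) hne x y
  have ext1 : ∀ (w : WordNot i) (b : HilbertTensor (H i) (FreeHilbertNot ξ i)),
      (∀ x y, ⟪headEmb ξ hξ i w.cons (wordCons ξ i w.1.1 (htmul x y)), b⟫_ℂ = 0) →
      ∀ z, ⟪headEmb ξ hξ i w.cons z, b⟫_ℂ = 0 := by
    intro w b h z
    obtain ⟨z, rfl⟩ := (wordCons ξ i w.1.1).surjective z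
    set g := (headEmb ξ hξ i w.cons).comp (wordCons ξ i w.1.1).toLinearIsometry with hg
    refine mem_of_htmul_mem
      { carrier := {z | ⟪g z, b⟫_ℂ = 0}
        zero_mem' := by
          simp only [Set.mem_ofPred_eq, map_zero, inner_zero_left]
        add_mem' := fun {p q} hp hq => by
          simp only [Set.mem_ofPred_eq] at *
          rw [map_add, inner_add_left, hp, hq, add_zero]
        smul_mem' := fun c p hp => by
          simp only [Set.mem_ofPred_eq] at *
          rw [map_smul, inner_smul_left, hp, mul_zero] }
      (isClosed_eq (g.continuous.inner continuous_const) continuous_const) h z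
  have mixed : ∀ (w w' : WordNot i) x y,
      ⟪headEmb ξ hξ i w.cons x, headEmb ξ hξ i w'.1 y⟫_ℂ = 0 := by
    intro w w' x y
    refine ext1 w _ (fun a b => ?_) x
    rw [headEmb_cons, headEmb_not, inner_htmul,
      Submodule.mem_orthogonal_singleton_iff_inner_left.1 a.2, zero_mul]
  intro w w' hne x y
  obtain ⟨w, rfl⟩ | ⟨w, rfl⟩ := word_cases i w <;>
  obtain ⟨w', rfl⟩ | ⟨w', rfl⟩ := word_cases i w'
  · rw [headEmb_not, headEmb_not, inner_htmul, key w w' (fun h => hne (by rw [h])), mul_zero]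
  · rw [← inner_conj_symm, mixed, map_zero]
  · exact mixed _ _ _ _
  · refine ext1 w _ (fun a b => ?_) x
    rw [← inner_conj_symm]
    refine (congrArg _ (ext1 w' _ (fun a' b' => ?_) y)).trans (map_zero _)
    rw [headEmb_cons, headEmb_cons, inner_htmul, key w' w (fun h => hne (by rw [h])), mul_zero]

theorem headEmb_isHilbertSum (ξ : ∀ i, H i) (hξ : ∀ i, ‖ξ i‖ = 1) (i : ι) :
    IsHilbertSum ℂ (fun w : Word ι => WordSpace ξ w.1) (headEmb ξ hξ i) := by
  refine IsHilbertSum.mk (headEmb_orthogonal ξ hξ i) ?_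
  set S := (⨆ w, LinearMap.range (headEmb ξ hξ i w).toLinearMap).topologicalClosure
  have hmem : ∀ w x, headEmb ξ hξ i w x ∈ S := fun w x =>
    Submodule.le_topologicalClosure _ (Submodule.mem_iSup_of_mem w ⟨x, rfl⟩)
  have hS : IsClosed (S : Set (HilbertTensor (H i) (FreeHilbertNot ξ i))) :=
    Submodule.isClosed_topologicalClosure _
  intro z _
  refine mem_of_htmul_mem S hS (fun x f => ?_) z
  have hsingle : ∀ (w : WordNot i) (y : WordSpace ξ w.1.1), htmul x
      (lpInclusion (G := fun w : WordNot i => WordSpace ξ w.1.1) w y) ∈ S := by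
    intro w y
    obtain ⟨a, ha, b, hb, rfl⟩ :=
      Submodule.exists_add_mem_mem_orthogonal (K := ℂ ∙ ξ i) x
    obtain ⟨c, rfl⟩ := Submodule.mem_span_singleton.1 ha
    rw [add_htmul, smul_htmul, ← headEmb_not ξ hξ]
    refine S.add_mem (S.smul_mem _ (hmem _ _)) ?_
    have := headEmb_cons ξ hξ i w ⟨b, hb⟩ y
    exact this ▸ hmem _ _
  have hsum := lp.hasSum_single (p := 2) (by norm_num) f
  have h2 := hsum.map
    ((htmulLinear x : FreeHilbertNot ξ i →ₗ[ℂ] HilbertTensor (H i) (FreeHilbertNot ξ i)))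
    (continuous_htmul x)
  refine hS.mem_of_tendsto h2 (Filter.Eventually.of_forall fun s => ?_)
  exact S.sum_mem fun w _ => hsingle w _

/-- The canonical unitary `U_i : H_i ⊗ H(i) → *_j H_j`. -/
def headUnitary (ξ : ∀ i, H i) (hξ : ∀ i, ‖ξ i‖ = 1) (i : ι) :
    HilbertTensor (H i) (FreeHilbertNot ξ i) ≃ₗᵢ[ℂ] FreeHilbert ξ :=
  (headEmb_isHilbertSum ξ hξ i).linearIsometryEquiv

/-- The canonical action `T ↦ U_i (T ⊗ 1) U_i*` of `B(H_i)` on the free product. -/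
def freeAction [∀ i, CompleteSpace (H i)] (ξ : ∀ i, H i) (hξ : ∀ i, ‖ξ i‖ = 1) (i : ι) :
    (H i →L[ℂ] H i) →⋆ₐ[ℂ] (FreeHilbert ξ →L[ℂ] FreeHilbert ξ) :=
  (headUnitary ξ hξ i).conjStarAlgEquiv.toStarAlgHom.comp ampliation

/-- The reduced free product `*_i (A_i, π_i, ξ_i)`: the C*-algebra of operators on the free product
Hilbert space generated by the images of all `A i`, acting through `π i`. -/
def reducedFreeProduct [∀ i, CompleteSpace (H i)] {A : ι → Type*} [∀ i, CStarAlgebra (A i)]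
    (π : ∀ i, A i →⋆ₐ[ℂ] (H i →L[ℂ] H i)) (ξ : ∀ i, H i) (hξ : ∀ i, ‖ξ i‖ = 1) :
    StarSubalgebra ℂ (FreeHilbert ξ →L[ℂ] FreeHilbert ξ) :=
  (StarAlgebra.adjoin ℂ
    (⋃ i, Set.range fun a : A i => freeAction ξ hξ i (π i a))).topologicalClosure

instance [∀ i, CompleteSpace (H i)] {A : ι → Type*} [∀ i, CStarAlgebra (A i)]
    (π : ∀ i, A i →⋆ₐ[ℂ] (H i →L[ℂ] H i)) (ξ : ∀ i, H i) (hξ : ∀ i, ‖ξ i‖ = 1) :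
    IsClosed (reducedFreeProduct π ξ hξ : Set (FreeHilbert ξ →L[ℂ] FreeHilbert ξ)) :=
  StarSubalgebra.isClosed_topologicalClosure _

/-- The canonical copy of `A i` in the reduced free product. -/
def incl [∀ i, CompleteSpace (H i)] {A : ι → Type*} [∀ i, CStarAlgebra (A i)]
    (π : ∀ i, A i →⋆ₐ[ℂ] (H i →L[ℂ] H i)) (ξ : ∀ i, H i) (hξ : ∀ i, ‖ξ i‖ = 1) (i : ι) :
    A i →⋆ₐ[ℂ] reducedFreeProduct π ξ hξ :=
  ((freeAction ξ hξ i).comp (π i)).codRestrict _ fun a =>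
    StarSubalgebra.le_topologicalClosure _
      (StarAlgebra.subset_adjoin ℂ _ (Set.mem_iUnion.2 ⟨i, a, rfl⟩))

end

end FreeProd

end

/-! Dilate, form the free product of the dilations, and compress back. Stinespring's theorem
(`exists_stinespring`) gives isometries $V_i:H_i\to K_i$ and representations $\sigma_i$ of $A'_i$
with $\pi_i\varphi_i(a)=V_i^*\sigma_i(a)V_i$. With $\eta_i=V_i\xi_i$, the vector states of
$(\sigma_i,\eta_i)$ and $(\pi'_i,\xi'_i)$ agree. If $\rho$ is the representation of the free product
of the $A'_i$ on the free product of the $(K_i,\eta_i)$, and $W$ is the isometry of free products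
induced by the $V_i$, then $\Phi(x)=W^*\rho(x)W$.

There are two difficulties. The first is the existence of $\rho$ (`exists_reducedFreeProduct_rep`),
since neither $\xi'_i$ nor $\eta_i$ need be cyclic. In the *-algebra of pairs $(S,T)$ generated by
the letters acting on both spaces, one shows $\|T\|\le\|S\|$. The vectors $v$ with $\|Tv\|\le
C\|S\|$ form a closed invariant subspace, in which $C$ can be improved to $\|v\|$
(`norm_snd_apply_le`). It contains the vacuum because the vacuum states agree. By induction on word
length it contains everything: the part of $K_i$ cyclic for $\eta_i$ is reached by invariance, and
for $h$ orthogonal to that part the compressions of $S$ and $T$ come from one element of $A'_i$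
(`exists_compression`), whose norm is at most $\|S\|$ because $\pi'_i$ is faithful.

The second is multiplicativity on reduced words (`wordProd_freeMap`). Applying a reduced word to
$Wv$ gives $W$ of the compressed word applied to $v$, plus an error orthogonal to the range of $W$
and supported on words with the same first letter. The next letter is centred and has a different
index, so it preserves this form of the error. Reduced words span a dense subspace, so $\Phi$ takes
values in the target free product. -/

noncomputable section

namespace FreeProd

universe u v w

/-! ### Positive matrices over C*-algebras and completely positive kernels. -/

/-- The negative part of a self-adjoint element, through the identity `N a N = - N³`. -/
theorem exists_negPart {R : Type*} [NonUnitalCStarAlgebra R] [PartialOrder R] [StarOrderedRing R]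
    (a : R) (ha : IsSelfAdjoint a) :
    ∃ N : R, star N = N ∧ N * a * N = -(N * N * N) ∧ (∃ s, N = star s * s) ∧ (N = 0 → 0 ≤ a) := by
  have hN0 : 0 ≤ a⁻ := CFC.negPart_nonneg a
  refine ⟨a⁻, (IsSelfAdjoint.of_nonneg hN0).star_eq, ?_,
    CStarAlgebra.nonneg_iff_eq_star_mul_self.1 hN0, (CFC.negPart_eq_zero_iff a ha).1⟩
  nth_rw 2 [← CFC.posPart_sub_negPart a ha]
  rw [mul_sub, CFC.negPart_mul_posPart, zero_sub, neg_mul]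

/-- Nonnegative elements are of the form `s* s`. -/
theorem exists_star_mul_self {R : Type*} [NonUnitalCStarAlgebra R] [PartialOrder R]
    [StarOrderedRing R] {a : R} (ha : 0 ≤ a) : ∃ s, a = star s * s :=
  CStarAlgebra.nonneg_iff_eq_star_mul_self.1 ha

/-- A self-adjoint matrix over a C*-algebra is nonnegative as soon as its quadratic form is. -/
theorem cstarMatrix_nonneg_of_forall {S : Type*} [CStarAlgebra S] [PartialOrder S]
    [StarOrderedRing S] {n : Type*} [Fintype n] (M : CStarMatrix n n S) (hM : IsSelfAdjoint M)
    (h : ∀ c : n → S, 0 ≤ ∑ i, ∑ j, star (c i) * M i j * c j) : 0 ≤ M := by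
  obtain ⟨N, hNs, hMN, ⟨s, hs⟩, hN⟩ := exists_negPart M hM
  -- Since $N=s^*s$, this gives $R^*R=N^3=-NMN$. The form at the $p$-th column of $N$ is the $(p,p)$
  -- entry of $NMN$, so the diagonal of $R^*R$ is both $\le 0$ and a sum of squares; hence $R=0$.
  set R := s * N with hR
  have hRR : star R * R = N * N * N := by
    rw [hR, star_mul, hNs, mul_assoc, ← mul_assoc (star s), ← hs, mul_assoc]
  have hdiag : ∀ p, ∑ i, star (R i p) * R i p = 0 := by
    intro p
    have h1 : (star R * R) p p = ∑ i, star (R i p) * R i p := by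
      rw [CStarMatrix.mul_apply]; rfl
    have h2 : 0 ≤ (N * M * N) p p := by
      have := h fun i => N i p
      have e : (N * M * N) p p = ∑ i, ∑ j, star (N i p) * M i j * N j p := by
        rw [CStarMatrix.mul_apply, Finset.sum_comm]
        refine Finset.sum_congr rfl fun j _ => ?_
        rw [CStarMatrix.mul_apply, Finset.sum_mul]
        refine Finset.sum_congr rfl fun i _ => ?_
        congr 2
        conv_lhs => rw [← hNs]
        rfl
      rwa [e]
    rw [hMN, ← hRR, CStarMatrix.neg_apply, h1] at h2
    exact le_antisymm (neg_nonneg.1 h2) (Finset.sum_nonneg fun i _ => star_mul_self_nonneg _)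
  have hR0 : R = 0 := by
    ext i p
    have := (Finset.sum_eq_zero_iff_of_nonneg fun i _ => star_mul_self_nonneg (R i p)).1
      (hdiag p) i (Finset.mem_univ i)
    rw [CStarMatrix.zero_apply]
    exact CStarRing.star_mul_self_eq_zero_iff _ |>.1 this
  have hN3 : N * N * N = 0 := by rw [← hRR, hR0, mul_zero]
  have hN4 : star (N * N) * (N * N) = 0 := by
    rw [star_mul, hNs, ← mul_assoc, hN3, zero_mul]
  have hN2 : star N * N = 0 := by
    rw [hNs]; exact CStarRing.star_mul_self_eq_zero_iff _ |>.1 hN4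
  have : N = 0 := CStarRing.star_mul_self_eq_zero_iff _ |>.1 hN2
  exact hN this

/-- The matrix `(aᵢ* aⱼ)` is nonnegative. -/
theorem cstarMatrix_star_mul_nonneg {A : Type*} [CStarAlgebra A] [PartialOrder A]
    [StarOrderedRing A] {n : Type*} [Fintype n] (a : n → A) :
    0 ≤ (CStarMatrix.ofMatrix (Matrix.of fun i j => star (a i) * a j) :
      CStarMatrix n n A) := by
  refine cstarMatrix_nonneg_of_forall _ ?_ fun c => ?_
  · ext i j
    simp [CStarMatrix.star_apply]
  · have : ∑ i, ∑ j, star (c i) * (star (a i) * a j) * c j =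
        star (∑ i, a i * c i) * ∑ i, a i * c i := by
      rw [star_sum, Finset.sum_mul_sum]
      simp [mul_assoc]
    exact (star_mul_self_nonneg (∑ i, a i * c i)).trans_eq this.symm

/-- A completely positive map into operators has a positive semidefinite kernel. -/
theorem completelyPositive_kernel_nonneg {A B H : Type*} [CStarAlgebra A] [PartialOrder A]
    [StarOrderedRing A] [CStarAlgebra B] [PartialOrder B] [StarOrderedRing B]
    [NormedAddCommGroup H] [InnerProductSpace ℂ H] [CompleteSpace H]
    (φ : A →CP B) (π : B →⋆ₐ[ℂ] (H →L[ℂ] H)) {n : Type*} [Fintype n] (a : n → A) (h : n → H) :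
    0 ≤ (∑ i, ∑ j, ⟪h i, π (φ (star (a i) * a j)) (h j)⟫_ℂ).re := by
  -- Writing $(\varphi(a_i^*a_j))=Z^*Z$ turns the kernel sum into
  -- $\sum_l\|\sum_i\pi(Z_{li})h_i\|^2$.
  have h1 := CompletelyPositiveMap.map_cstarMatrix_nonneg φ _ (cstarMatrix_star_mul_nonneg a)
  obtain ⟨Z, hZ⟩ := exists_star_mul_self h1
  have h2 : ∀ i j, φ (star (a i) * a j) = ∑ l, star (Z l i) * Z l j := fun i j => by
    have := congrFun (congrFun hZ i) j
    rw [CStarMatrix.mul_apply] at this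
    exact this
  have h3 : ∑ i, ∑ j, ⟪h i, π (φ (star (a i) * a j)) (h j)⟫_ℂ =
      ∑ l, ⟪∑ i, π (Z l i) (h i), ∑ j, π (Z l j) (h j)⟫_ℂ := by
    simp_rw [h2, map_sum, sum_apply, inner_sum, sum_inner, map_mul, map_star,
      ContinuousLinearMap.star_eq_adjoint, mul_apply_eq_comp,
      ContinuousLinearMap.adjoint_inner_right]
    rw [Finset.sum_congr rfl fun i _ => Finset.sum_comm, Finset.sum_comm]
    exact Finset.sum_congr rfl fun i _ => Finset.sum_comm
  rw [h3, Complex.re_sum]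
  exact Finset.sum_nonneg fun l _ => inner_self_nonneg (𝕜 := ℂ)

/-- Completely positive maps preserve adjoints. -/
theorem completelyPositive_map_star {A B : Type*} [CStarAlgebra A] [PartialOrder A]
    [StarOrderedRing A] [CStarAlgebra B] [PartialOrder B] [StarOrderedRing B]
    (φ : A →CP B) (a : A) : φ (star a) = star (φ a) := by
  -- The off-diagonal entries of this $2\times2$ matrix are $\varphi(a)$ and $\varphi(a^*)$, and a
  -- positive matrix is self-adjoint.
  have h1 := CompletelyPositiveMap.map_cstarMatrix_nonneg φ _
    (cstarMatrix_star_mul_nonneg ![1, a])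
  obtain ⟨Z, hZ⟩ := exists_star_mul_self h1
  have h2 := congrArg star hZ
  rw [star_mul, star_star, ← hZ] at h2
  simpa [CStarMatrix.star_apply] using (congrFun (congrFun h2 1) 0).symm

/-! ### Stinespring dilation through a reproducing kernel space. -/

section Stinespring

variable {A : Type u} [CStarAlgebra A]
  {H : Type v} [NormedAddCommGroup H] [InnerProductSpace ℂ H] [CompleteSpace H]

/-- The operator kernel `(x, y) ↦ θ (x* y)`. -/
def stinespringKernel (θ : A →ₗ[ℂ] (H →L[ℂ] H)) : Matrix A A (H →L[ℂ] H) :=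
  Matrix.of fun x y => θ (star x * y)

theorem stinespringKernel_posSemidef (θ : A →ₗ[ℂ] (H →L[ℂ] H))
    (hstar : ∀ a, θ (star a) = star (θ a))
    (hpos : ∀ (s : Finset A) (h : A → H),
      0 ≤ (∑ x ∈ s, ∑ y ∈ s, ⟪h x, θ (star x * y) (h y)⟫_ℂ).re) :
    (stinespringKernel θ).PosSemidef := by
  have key : _ ∧ _ → (stinespringKernel θ).PosSemidef := (RKHS.posSemidef_tfae.out 0 2).2
  refine key ⟨?_, fun f => ?_⟩
  · ext1 x y
    simp [stinespringKernel, ← hstar]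
  · have := hpos f.support f
    rw [Finset.sum_comm, ← Complex.conj_re, map_sum] at this
    simpa [Finsupp.sum, stinespringKernel, map_sum, inner_conj_symm] using this

variable (θ : A →ₗ[ℂ] (H →L[ℂ] H)) [hθ : Fact (stinespringKernel θ).PosSemidef]

/-- The Stinespring space of a completely positive map. -/
abbrev StinespringSpace : Type (max u v) := RKHS.OfKernel (stinespringKernel θ)

/-- The class of `x ⊗ v` in the Stinespring space. -/
def stinespringVec (x : A) : H →L[ℂ] StinespringSpace θ := RKHS.kerFun (StinespringSpace θ) x

/-- The reproducing property: kernel functions play the part of the classes $x\otimes v$ in the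
usual quotient construction. -/
theorem inner_stinespringVec (x y : A) (v w : H) :
    ⟪stinespringVec θ x v, stinespringVec θ y w⟫_ℂ = ⟪v, θ (star x * y) w⟫_ℂ := by
  rw [← inner_conj_symm, stinespringVec, stinespringVec, ← RKHS.kernel_inner,
    RKHS.OfKernel.kernel_ofKernel, inner_conj_symm]
  rfl

theorem stinespringVec_ext_inner {f g : StinespringSpace θ}
    (h : ∀ x v, ⟪stinespringVec θ x v, f⟫_ℂ = ⟪stinespringVec θ x v, g⟫_ℂ) : f = g := by
  refine RKHS.ext fun x => ext_inner_left ℂ fun v => ?_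
  rw [← RKHS.kerFun_inner, ← RKHS.kerFun_inner]
  exact h x v

theorem stinespringVec_ext {E : Type*} [NormedAddCommGroup E] [InnerProductSpace ℂ E]
    {S T : StinespringSpace θ →L[ℂ] E}
    (h : ∀ x v, S (stinespringVec θ x v) = T (stinespringVec θ x v)) : S = T := by
  refine ContinuousLinearMap.ext_on
    ((Submodule.dense_iff_topologicalClosure_eq_top).2
      (RKHS.kerFun_dense (StinespringSpace θ))) ?_
  rintro _ ⟨x, v, rfl⟩
  exact h x v

theorem stinespringVec_add (x y : A) (v : H) :
    stinespringVec θ (x + y) v = stinespringVec θ x v + stinespringVec θ y v :=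
  stinespringVec_ext_inner θ fun z w => by
    simp [inner_add_right, inner_stinespringVec, mul_add]

theorem stinespringVec_smul (c : ℂ) (x : A) (v : H) :
    stinespringVec θ (c • x) v = c • stinespringVec θ x v :=
  stinespringVec_ext_inner θ fun z w => by
    simp [inner_smul_right, inner_stinespringVec]

/-- The canonical map from finitely supported functions to the Stinespring space. -/
def stinespringQuot : (A →₀ H) →ₗ[ℂ] StinespringSpace θ :=
  Finsupp.lsum ℂ fun x => (stinespringVec θ x).toLinearMap

/-- Left multiplication before passing to the quotient. -/
def stinespringPre (a : A) : (A →₀ H) →ₗ[ℂ] StinespringSpace θ :=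
  Finsupp.lsum ℂ fun x => (stinespringVec θ (a * x)).toLinearMap

theorem stinespringQuot_single (x : A) (v : H) :
    stinespringQuot θ (Finsupp.single x v) = stinespringVec θ x v := by
  simp [stinespringQuot]

theorem stinespringPre_single (a x : A) (v : H) :
    stinespringPre θ a (Finsupp.single x v) = stinespringVec θ (a * x) v := by
  simp [stinespringPre]

theorem stinespringQuot_denseRange : DenseRange (stinespringQuot θ) := by
  have h := (Submodule.dense_iff_topologicalClosure_eq_top).2
      (RKHS.kerFun_dense (StinespringSpace θ))
  refine h.mono ?_
  rw [← LinearMap.coe_range, SetLike.coe_subset_coe, Submodule.span_le]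
  rintro _ ⟨x, v, rfl⟩
  exact ⟨Finsupp.single x v, stinespringQuot_single θ x v⟩

theorem inner_stinespringPre (a b : A) (f g : A →₀ H) :
    ⟪stinespringPre θ a f, stinespringPre θ b g⟫_ℂ =
      ⟪stinespringQuot θ f, stinespringPre θ (star a * b) g⟫_ℂ := by
  simp only [stinespringPre, stinespringQuot, Finsupp.lsum_apply, Finsupp.sum_inner,
    Finsupp.inner_sum, ContinuousLinearMap.coe_coe, inner_stinespringVec, star_mul, mul_assoc]

variable [PartialOrder A] [StarOrderedRing A]

/-- Write $\|a\|^2-a^*a=b^*b$; then $\|af\|^2+\|bf\|^2=\|a\|^2\|f\|^2$ in the kernel seminorm. This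
makes left multiplication both well defined on the quotient and bounded. -/
theorem stinespringPre_norm_le (a : A) (f : A →₀ H) :
    ‖stinespringPre θ a f‖ ≤ ‖a‖ * ‖stinespringQuot θ f‖ := by
  have h0 : 0 ≤ algebraMap ℝ A (‖a‖ ^ 2) - star a * a := by
    rw [sub_nonneg]
    have := CStarAlgebra.star_mul_le_algebraMap_norm_sq (a := a)
    exact this
  obtain ⟨b, hb⟩ := exists_star_mul_self h0
  have h1 : star a * a + star b * b = ((‖a‖ ^ 2 : ℝ) : ℂ) • (1 : A) := by
    rw [← hb, add_sub_cancel, Algebra.algebraMap_eq_smul_one, Complex.coe_smul]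
  have hadd : ∀ x y : A, stinespringPre θ (x + y) f = stinespringPre θ x f + stinespringPre θ y f := by
    intro x y
    simp only [stinespringPre, Finsupp.lsum_apply, ContinuousLinearMap.coe_coe, add_mul,
      Finsupp.sum, stinespringVec_add, Finset.sum_add_distrib]
  have hsmul : ∀ c : ℂ, stinespringPre θ (c • 1) f = c • stinespringQuot θ f := by
    intro c
    simp only [stinespringPre, stinespringQuot, Finsupp.lsum_apply, ContinuousLinearMap.coe_coe,
      smul_mul_assoc, one_mul, Finsupp.sum, stinespringVec_smul, Finset.smul_sum]
  have h2 : ⟪stinespringPre θ a f, stinespringPre θ a f⟫_ℂ +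
      ⟪stinespringPre θ b f, stinespringPre θ b f⟫_ℂ =
      ((‖a‖ ^ 2 : ℝ) : ℂ) * ⟪stinespringQuot θ f, stinespringQuot θ f⟫_ℂ := by
    rw [inner_stinespringPre, inner_stinespringPre, ← inner_add_right, ← hadd, h1, hsmul,
      inner_smul_right]
  simp only [inner_self_eq_norm_sq_to_K, Complex.coe_algebraMap] at h2
  have h3 : ‖stinespringPre θ a f‖ ^ 2 + ‖stinespringPre θ b f‖ ^ 2 =
      ‖a‖ ^ 2 * ‖stinespringQuot θ f‖ ^ 2 := by exact_mod_cast h2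
  refine abs_le_of_sq_le_sq' ?_ (by positivity) |>.2
  nlinarith [sq_nonneg ‖stinespringPre θ b f‖]

/-- Left multiplication on the Stinespring space. -/
def stinespringMul (a : A) : StinespringSpace θ →L[ℂ] StinespringSpace θ :=
  (stinespringPre θ a).extendOfNorm (stinespringQuot θ)

theorem stinespringMul_vec (a x : A) (v : H) :
    stinespringMul θ a (stinespringVec θ x v) = stinespringVec θ (a * x) v := by
  rw [← stinespringQuot_single, stinespringMul,
    LinearMap.extendOfNorm_eq (stinespringQuot_denseRange θ) ⟨_, stinespringPre_norm_le θ a⟩,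
    stinespringPre_single]

/-- The Stinespring representation. -/
def stinespringRep : A →⋆ₐ[ℂ] (StinespringSpace θ →L[ℂ] StinespringSpace θ) where
  toFun := stinespringMul θ
  map_one' := stinespringVec_ext θ fun x v => by simp [stinespringMul_vec]
  map_mul' a b := stinespringVec_ext θ fun x v => by simp [stinespringMul_vec, mul_assoc]
  map_zero' := stinespringVec_ext θ fun x v => by
    rw [stinespringMul_vec, zero_mul, zero_apply, ← zero_smul ℂ (0 : A), stinespringVec_smul,
      zero_smul]
  map_add' a b := stinespringVec_ext θ fun x v => by
    simp [stinespringMul_vec, add_mul, stinespringVec_add]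
  commutes' c := stinespringVec_ext θ fun x v => by
    simp [stinespringMul_vec, Algebra.algebraMap_eq_smul_one, stinespringVec_smul]
  map_star' a := stinespringVec_ext θ fun x v => stinespringVec_ext_inner θ fun y w => by
    rw [ContinuousLinearMap.star_eq_adjoint, ContinuousLinearMap.adjoint_inner_right,
      stinespringMul_vec, stinespringMul_vec, inner_stinespringVec, inner_stinespringVec,
      star_mul, mul_assoc]

end Stinespring

/-- Stinespring's dilation theorem. -/
theorem exists_stinespring {A : Type u} [CStarAlgebra A] [PartialOrder A] [StarOrderedRing A]
    {H : Type v} [NormedAddCommGroup H] [InnerProductSpace ℂ H] [CompleteSpace H]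
    (θ : A →ₗ[ℂ] (H →L[ℂ] H)) (h1 : θ 1 = 1) (hstar : ∀ a, θ (star a) = star (θ a))
    (hpos : ∀ (s : Finset A) (h : A → H),
      0 ≤ (∑ x ∈ s, ∑ y ∈ s, ⟪h x, θ (star x * y) (h y)⟫_ℂ).re) :
    ∃ (K : Hilb.{max u v}) (σ : A →⋆ₐ[ℂ] (K.carrier →L[ℂ] K.carrier))
      (V : H →ₗᵢ[ℂ] K.carrier), ∀ a h k, ⟪V h, σ a (V k)⟫_ℂ = ⟪h, θ a k⟫_ℂ := by
  have : Fact (stinespringKernel θ).PosSemidef := ⟨stinespringKernel_posSemidef θ hstar hpos⟩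
  refine ⟨⟨StinespringSpace θ⟩, stinespringRep θ, ⟨(stinespringVec θ 1).toLinearMap, fun v => ?_⟩,
    fun a h k => ?_⟩
  · have h2 := inner_stinespringVec θ 1 1 v v
    rw [star_one, one_mul, h1, inner_self_eq_norm_sq_to_K, one_apply_eq_self,
      inner_self_eq_norm_sq_to_K] at h2
    have h3 : ‖stinespringVec θ 1 v‖ ^ 2 = ‖v‖ ^ 2 := by exact_mod_cast h2
    exact (sq_eq_sq₀ (norm_nonneg _) (norm_nonneg _)).1 h3
  · change ⟪stinespringVec θ 1 h, stinespringMul θ a (stinespringVec θ 1 k)⟫_ℂ = _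
    rw [stinespringMul_vec, inner_stinespringVec, star_one, one_mul, mul_one]

/-- Decomposition of a vector along `ξ`. -/
theorem exists_smul_add {E : Type*} [NormedAddCommGroup E] [InnerProductSpace ℂ E] (ξ h : E) :
    ∃ (c : ℂ) (k : (ℂ ∙ ξ)ᗮ), h = c • ξ + (k : E) := by
  obtain ⟨a, ha, b, hb, rfl⟩ := Submodule.exists_add_mem_mem_orthogonal (K := ℂ ∙ ξ) h
  obtain ⟨c, rfl⟩ := Submodule.mem_span_singleton.1 ha
  exact ⟨c, ⟨b, hb⟩, rfl⟩

/-! ### Elementary tensors $U_i(h\otimes r)$ in the free product space. -/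

section Words

variable {ι : Type u} [DecidableEq ι] {H : ι → Type v}
  [∀ i, NormedAddCommGroup (H i)] [∀ i, InnerProductSpace ℂ (H i)]

/-- The inclusion of the summand of a word in the free product Hilbert space. -/
def wordEmb (ξ : ∀ i, H i) (w : Word ι) : WordSpace ξ w.1 →ₗᵢ[ℂ] FreeHilbert ξ :=
  lpInclusion (G := fun w : Word ι => WordSpace ξ w.1) w

theorem wordEmb_orthogonal (ξ : ∀ i, H i) {w w' : Word ι} (h : w ≠ w') (x : WordSpace ξ w.1)
    (y : WordSpace ξ w'.1) : ⟪wordEmb ξ w x, wordEmb ξ w' y⟫_ℂ = 0 :=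
  lpInclusion_orthogonal (G := fun w : Word ι => WordSpace ξ w.1) h x y

theorem wordEmb_orthogonal_of_length (ξ : ∀ i, H i) {w w' : Word ι}
    (h : w.1.length ≠ w'.1.length) (x : WordSpace ξ w.1)
    (y : WordSpace ξ w'.1) : ⟪wordEmb ξ w x, wordEmb ξ w' y⟫_ℂ = 0 :=
  wordEmb_orthogonal ξ (fun e => h (by rw [e])) x y

/-- A closed submodule containing all summands is everything. -/
theorem mem_of_wordEmb_mem (ξ : ∀ i, H i) (S : Submodule ℂ (FreeHilbert ξ))
    (hS : IsClosed (S : Set (FreeHilbert ξ))) (h : ∀ w x, wordEmb ξ w x ∈ S)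
    (z : FreeHilbert ξ) : z ∈ S :=
  hS.mem_of_tendsto (lp.hasSum_single (p := 2) (by norm_num) z)
    (Filter.Eventually.of_forall fun _ => S.sum_mem fun w _ => h w _)

/-- A closed submodule contains the summand of `i w` if it contains its elementary tensors. -/
theorem wordEmb_cons_mem (ξ : ∀ i, H i) {i : ι} (w : WordNot i) (S : Submodule ℂ (FreeHilbert ξ))
    (hS : IsClosed (S : Set (FreeHilbert ξ)))
    (h : ∀ (k : (ℂ ∙ ξ i)ᗮ) (r : WordSpace ξ w.1.1),
      wordEmb ξ w.cons (wordCons ξ i w.1.1 (htmul k r)) ∈ S) (x : WordSpace ξ w.cons.1) :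
    wordEmb ξ w.cons x ∈ S := by
  obtain ⟨x, rfl⟩ := (wordCons ξ i w.1.1).surjective x
  let g := (wordEmb ξ w.cons).comp (wordCons ξ i w.1.1).toLinearIsometry
  exact mem_of_htmul_mem (S.comap g.toLinearMap) (hS.preimage g.continuous) h x

variable (ξ : ∀ i, H i) (hξ : ∀ i, ‖ξ i‖ = 1)

/-- The vector `U_i (h ⊗ r)`, for `r` in the summand of a word not beginning with `i`. -/
def headTensor (i : ι) (w : WordNot i) (h : H i) (r : WordSpace ξ w.1.1) : FreeHilbert ξ :=
  headUnitary ξ hξ i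
    (htmul h (lpInclusion (G := fun w : WordNot i => WordSpace ξ w.1.1) w r))

theorem headUnitary_headEmb (i : ι) (w : Word ι) (x : WordSpace ξ w.1) :
    headUnitary ξ hξ i (headEmb ξ hξ i w x) = wordEmb ξ w x := by
  have h := (headEmb_isHilbertSum ξ hξ i).linearIsometryEquiv_symm_apply_single (i := w) x
  rw [← h]
  exact (headUnitary ξ hξ i).apply_symm_apply _

theorem headTensor_self (i : ι) (w : WordNot i) (r : WordSpace ξ w.1.1) :
    headTensor ξ hξ i w (ξ i) r = wordEmb ξ w.1 r := by
  rw [headTensor, ← headEmb_not ξ hξ, headUnitary_headEmb]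

theorem headTensor_coe (i : ι) (w : WordNot i) (k : (ℂ ∙ ξ i)ᗮ) (r : WordSpace ξ w.1.1) :
    headTensor ξ hξ i w (k : H i) r = wordEmb ξ w.cons (wordCons ξ i w.1.1 (htmul k r)) := by
  rw [headTensor, ← headEmb_cons ξ hξ, headUnitary_headEmb]

theorem headTensor_of_inner_eq_zero (i : ι) (w : WordNot i) (k : H i) (hk : ⟪ξ i, k⟫_ℂ = 0)
    (r : WordSpace ξ w.1.1) : ∃ x, headTensor ξ hξ i w k r = wordEmb ξ w.cons x :=
  ⟨_, headTensor_coe ξ hξ i w ⟨k, Submodule.mem_orthogonal_singleton_iff_inner_right.2 hk⟩ r⟩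

/-- `headTensor` as a linear map in the first variable. -/
def headTensorLeft (i : ι) (w : WordNot i) (r : WordSpace ξ w.1.1) : H i →ₗ[ℂ] FreeHilbert ξ where
  toFun h := headTensor ξ hξ i w h r
  map_add' h k := by simp [headTensor, add_htmul]
  map_smul' c h := by simp [headTensor, smul_htmul]

theorem inner_headTensor (i : ι) (w w' : WordNot i) (h h' : H i) (r : WordSpace ξ w.1.1)
    (r' : WordSpace ξ w'.1.1) :
    ⟪headTensor ξ hξ i w h r, headTensor ξ hξ i w' h' r'⟫_ℂ =
      ⟪h, h'⟫_ℂ * ⟪wordEmb ξ w.1 r, wordEmb ξ w'.1 r'⟫_ℂ := by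
  rw [headTensor, headTensor, LinearIsometryEquiv.inner_map_map, inner_htmul]
  congr 1
  by_cases e : w = w'
  · subst e
    rw [LinearIsometry.inner_map_map, LinearIsometry.inner_map_map]
  · rw [lpInclusion_orthogonal (G := fun w : WordNot i => WordSpace ξ w.1.1) e,
      wordEmb_orthogonal ξ fun e' => e (Subtype.ext e')]

theorem norm_headTensor (i : ι) (w : WordNot i) (h : H i) (r : WordSpace ξ w.1.1) :
    ‖headTensor ξ hξ i w h r‖ = ‖h‖ * ‖r‖ := by
  rw [headTensor, LinearIsometryEquiv.norm_map, norm_htmul, LinearIsometry.norm_map]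

theorem continuous_headTensor (i : ι) (w : WordNot i) (r : WordSpace ξ w.1.1) :
    Continuous fun h => headTensor ξ hξ i w h r :=
  ((headTensorLeft ξ hξ i w r).mkContinuous ‖r‖
    fun h => (norm_headTensor ξ hξ i w h r).le.trans_eq (mul_comm _ _)).continuous

/-- The $\xi_i$-component of $h$ keeps the word $w$ and the rest creates the letter $i$. Only the
lengths $|w|$ and $|w|+1$ occur, which drives the orthogonality arguments below. -/
theorem headTensor_decomp (i : ι) (w : WordNot i) (h : H i) (r : WordSpace ξ w.1.1) :
    ∃ (c : ℂ) (x : WordSpace ξ w.cons.1),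
      headTensor ξ hξ i w h r = c • wordEmb ξ w.1 r + wordEmb ξ w.cons x := by
  obtain ⟨c, k, rfl⟩ := exists_smul_add (ξ i) h
  refine ⟨c, wordCons ξ i w.1.1 (htmul k r), ?_⟩
  rw [← headTensor_coe ξ hξ, ← headTensor_self ξ hξ]
  exact ((headTensorLeft ξ hξ i w r).map_add _ _).trans
    (congrArg (· + _) ((headTensorLeft ξ hξ i w r).map_smul _ _))

/-- A closed submodule containing all vectors `U_i (h ⊗ r)` is everything. -/
theorem mem_of_headTensor_mem (i : ι) (S : Submodule ℂ (FreeHilbert ξ))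
    (hS : IsClosed (S : Set (FreeHilbert ξ))) (h : ∀ w k r, headTensor ξ hξ i w k r ∈ S)
    (z : FreeHilbert ξ) : z ∈ S := by
  refine mem_of_wordEmb_mem ξ S hS (fun w x => ?_) z
  obtain ⟨w, rfl⟩ | ⟨w, rfl⟩ := word_cases i w
  · exact headTensor_self ξ hξ i w x ▸ h _ _ _
  · exact wordEmb_cons_mem ξ w S hS (fun k r => headTensor_coe ξ hξ i w k r ▸ h _ _ _) x

theorem freeAction_headTensor [∀ i, CompleteSpace (H i)] (i : ι) (T : H i →L[ℂ] H i)
    (w : WordNot i) (h : H i) (r : WordSpace ξ w.1.1) :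
    freeAction ξ hξ i T (headTensor ξ hξ i w h r) = headTensor ξ hξ i w (T h) r := by
  rw [headTensor, headTensor, ← ampliation_htmul]
  change headUnitary ξ hξ i (ampliation T ((headUnitary ξ hξ i).symm (headUnitary ξ hξ i _))) = _
  rw [LinearIsometryEquiv.symm_apply_apply]

theorem freeAction_wordEmb [∀ i, CompleteSpace (H i)] (i : ι) (T : H i →L[ℂ] H i)
    (w : WordNot i) (r : WordSpace ξ w.1.1) :
    freeAction ξ hξ i T (wordEmb ξ w.1 r) = headTensor ξ hξ i w (T (ξ i)) r := by
  rw [← headTensor_self ξ hξ, freeAction_headTensor]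

end Words

/-! ### Reduced words span the generated *-algebra. -/

section Reduced

variable {ι : Type u} {A : ι → Type*}

/-- Words in the `A i` with alternating letters, all annihilated by the functionals `ω i`. -/
def IsReduced (ω : ∀ i, A i → ℂ) (l : List (Σ i, A i)) : Prop :=
  (l.map Sigma.fst).IsChain (· ≠ ·) ∧ ∀ p ∈ l, ω p.1 p.2 = 0

/-- The product of the letters of a word, mapped by `f`. -/
def wordProd {X : Type*} [Monoid X] (f : ∀ i, A i → X) (l : List (Σ i, A i)) : X :=
  (l.map fun p => f p.1 p.2).prod

@[simp] theorem wordProd_nil {X : Type*} [Monoid X] (f : ∀ i, A i → X) : wordProd f [] = 1 := rfl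

@[simp] theorem wordProd_cons {X : Type*} [Monoid X] (f : ∀ i, A i → X) (p : Σ i, A i)
    (l : List (Σ i, A i)) : wordProd f (p :: l) = f p.1 p.2 * wordProd f l := by
  simp [wordProd]

theorem wordProd_append {X : Type*} [Monoid X] (f : ∀ i, A i → X) (l l' : List (Σ i, A i)) :
    wordProd f (l ++ l') = wordProd f l * wordProd f l' := by
  simp [wordProd]

theorem map_wordProd {X Y G : Type*} [Monoid X] [Monoid Y] [FunLike G X Y]
    [MonoidHomClass G X Y] (g : G) (f : ∀ i, A i → X)
    (l : List (Σ i, A i)) : g (wordProd f l) = wordProd (fun i a => g (f i a)) l := by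
  simp [wordProd, map_list_prod, Function.comp_def]

theorem IsReduced.tail {ω : ∀ i, A i → ℂ} {p : Σ i, A i} {l : List (Σ i, A i)}
    (h : IsReduced ω (p :: l)) : IsReduced ω l :=
  ⟨List.IsChain.tail h.1, fun q hq => h.2 q (List.mem_cons_of_mem _ hq)⟩

/-- The *-algebra generated by the ranges of *-homomorphisms `f i` is spanned by the products of
reduced words. -/
theorem adjoin_le_span_wordProd [∀ i, Ring (A i)] [∀ i, Algebra ℂ (A i)] [∀ i, StarRing (A i)]
    {X : Type*} [Ring X] [Algebra ℂ X] [StarRing X] [StarModule ℂ X]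
    (f : ∀ i, A i →⋆ₐ[ℂ] X) (ω : ∀ i, A i →ₗ[ℂ] ℂ) (hω : ∀ i, ω i 1 = 1) {x : X}
    (hx : x ∈ StarAlgebra.adjoin ℂ (⋃ i, Set.range (f i))) :
    x ∈ Submodule.span ℂ (wordProd (fun i => f i) '' {l | IsReduced (fun i => ω i) l}) := by
  set S := Submodule.span ℂ (wordProd (fun i => f i) '' {l | IsReduced (fun i => ω i) l})
  have hstar : star (⋃ i, Set.range (f i)) = ⋃ i, Set.range (f i) := by
    ext y
    simp only [Set.mem_star, Set.mem_iUnion, Set.mem_range]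
    refine exists_congr fun i => ⟨fun ⟨a, ha⟩ => ⟨star a, ?_⟩, fun ⟨a, ha⟩ => ⟨star a, ?_⟩⟩
    · rw [map_star, ha, star_star]
    · rw [map_star, ha]
  have hcenter : ∀ i (a : A i), ω i (a - ω i a • 1) = 0 := fun i a => by simp [hω]
  have hred : ∀ l, IsReduced (fun i => ω i) l → wordProd (fun i => f i) l ∈ S :=
    fun l hl => Submodule.subset_span ⟨l, hl, rfl⟩
  have hpush : ∀ i (a : A i) l, IsReduced (fun i => ω i) l → l.head?.map Sigma.fst ≠ some i →
      f i a * wordProd (fun i => f i) l ∈ S := by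
    intro i a l hl hne
    -- Split $a$ into its centred part, which extends the reduced word, and a scalar, which leaves
    -- it unchanged.
    have e : f i a * wordProd (fun i => f i) l =
        wordProd (fun i => f i) (⟨i, a - ω i a • 1⟩ :: l) +
          ω i a • wordProd (fun i => f i) l := by
      simp [sub_mul, map_sub]
    rw [e]
    refine S.add_mem (hred _ ⟨?_, ?_⟩) (S.smul_mem _ (hred l hl))
    · rw [List.map_cons, List.isChain_cons]
      refine ⟨fun y hy hiy => hne ?_, hl.1⟩
      rw [← List.head?_map]
      exact (Option.mem_def.1 hy).trans (congrArg some hiy.symm)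
    · rintro p (_ | ⟨_, hp⟩)
      · exact hcenter i a
      · exact hl.2 p hp
  have hmul : ∀ i (a : A i) y, y ∈ S → f i a * y ∈ S := by
    intro i a y hy
    induction hy using Submodule.span_induction with
    | zero => simp
    | add y z _ _ hy hz => rw [mul_add]; exact S.add_mem hy hz
    | smul c y _ hy => rw [mul_smul_comm]; exact S.smul_mem _ hy
    | mem y hy =>
      obtain ⟨l, hl, rfl⟩ := hy
      by_cases hne : l.head?.map Sigma.fst = some i
      · match l, hl, hne with
        | ⟨j, b⟩ :: t, hl, hne =>
          replace hl : IsReduced (fun i => ω i) (⟨j, b⟩ :: t) := hl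
          obtain rfl : j = i := by simpa using hne
          -- Equal adjacent indices merge into one letter $ab$, and the tail no longer begins with
          -- that index.
          rw [wordProd_cons, ← mul_assoc, ← map_mul]
          refine hpush j (a * b) t hl.tail fun h => ?_
          have h1 := hl.1
          rw [List.map_cons, List.isChain_cons, List.head?_map] at h1
          exact h1.1 j (Option.mem_def.2 h) rfl
      · exact hpush i a l hl hne
  rw [← StarSubalgebra.mem_toSubalgebra, StarAlgebra.adjoin_toSubalgebra, hstar, Set.union_self,
    ← Subalgebra.mem_toSubmodule, Algebra.adjoin_eq_span] at hx
  refine Submodule.span_le.2 (fun y hy => ?_) hx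
  induction hy using Submonoid.closure_induction_left with
  | one => exact hred [] ⟨by simp, by simp⟩
  | mul_left y hy z _ hz =>
    obtain ⟨i, a, rfl⟩ := Set.mem_iUnion.1 hy
    exact hmul i a z hz

end Reduced

/-! ### Action of reduced words on the summands. -/

section Moves

variable {ι : Type u} [DecidableEq ι] {H : ι → Type v}
  [∀ i, NormedAddCommGroup (H i)] [∀ i, InnerProductSpace ℂ (H i)] [∀ i, CompleteSpace (H i)]
  {A : ι → Type*} (ξ : ∀ i, H i) (hξ : ∀ i, ‖ξ i‖ = 1) (π : ∀ i, A i → (H i →L[ℂ] H i))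

/-- A reduced word moves the summand of `w` into the summand of the concatenated word. -/
theorem wordProd_wordEmb (l : List (Σ i, A i))
    (hl : ∀ p ∈ l, ⟪ξ p.1, π p.1 p.2 (ξ p.1)⟫_ℂ = 0) (w : Word ι)
    (h : (l.map Sigma.fst ++ w.1).IsChain (· ≠ ·)) (x : WordSpace ξ w.1) :
    ∃ y, wordProd (fun i a => freeAction ξ hξ i (π i a)) l (wordEmb ξ w x) =
      wordEmb ξ ⟨l.map Sigma.fst ++ w.1, h⟩ y := by
  induction l with
  | nil => exact ⟨x, rfl⟩
  | cons p l ih =>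
    obtain ⟨y, hy⟩ := ih (fun q hq => hl q (List.mem_cons_of_mem _ hq)) (List.IsChain.tail h)
    rw [wordProd_cons, mul_apply_eq_comp, hy]
    -- A centred letter acts on a word not beginning with its index as a creation operator, because
    -- it sends $\xi$ into $\xi^\perp$.
    let w' : WordNot p.1 := tailNot p.1 (l.map Sigma.fst ++ w.1) h
    obtain ⟨z, hz⟩ := headTensor_of_inner_eq_zero ξ hξ p.1 w' (π p.1 p.2 (ξ p.1))
      (hl p List.mem_cons_self) y
    exact ⟨z, (freeAction_wordEmb ξ hξ p.1 (π p.1 p.2) w' y).trans hz⟩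

/-- A nonempty reduced word has vanishing vacuum expectation. -/
theorem inner_wordProd_vacuum (l : List (Σ i, A i)) (hne : l ≠ [])
    (hl : IsReduced (fun i a => ⟪ξ i, π i a (ξ i)⟫_ℂ) l)
    (x : WordSpace ξ ([] : List ι)) :
    ⟪wordEmb ξ ⟨[], List.IsChain.nil⟩ x, wordProd (fun i a => freeAction ξ hξ i (π i a)) l
      (wordEmb ξ ⟨[], List.IsChain.nil⟩ x)⟫_ℂ = 0 := by
  obtain ⟨y, hy⟩ := wordProd_wordEmb ξ hξ π l hl.2 ⟨[], List.IsChain.nil⟩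
    (by simpa using hl.1) x
  rw [hy]
  refine wordEmb_orthogonal_of_length ξ ?_ _ _
  simpa [eq_comm] using hne

/-- A nonempty reduced word not ending in `i` has vanishing compression to `H i ⊗ r`. -/
theorem inner_wordProd_headTensor (i : ι) (l : List (Σ i, A i)) (hne : l ≠ [])
    (hl : ∀ p ∈ l, ⟪ξ p.1, π p.1 p.2 (ξ p.1)⟫_ℂ = 0)
    (hi : (l.map Sigma.fst ++ [i]).IsChain (· ≠ ·)) (w : WordNot i) (r : WordSpace ξ w.1.1)
    (h k : H i) (hw : ⟪ξ i, h⟫_ℂ = 0 ∨ w.1.1 = []) :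
    ⟪headTensor ξ hξ i w k r, wordProd (fun i a => freeAction ξ hξ i (π i a)) l
      (headTensor ξ hξ i w h r)⟫_ℂ = 0 := by
  have hlen : l.length ≠ 0 := by simpa using hne
  have hchain : (l.map Sigma.fst ++ i :: w.1.1).IsChain (· ≠ ·) := by
    have h1 := w.cons.2
    have : l.map Sigma.fst ++ i :: w.1.1 = (l.map Sigma.fst) ++ [i] ++ w.1.1 := by simp
    rw [this]
    exact List.IsChain.append_overlap hi h1 (by simp)
  -- The image has length $|l|+1+|w|$, which exceeds the lengths $|w|$ and $|w|+1$ in the other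
  -- vector.
  have hcons : ∀ x : WordSpace ξ w.cons.1, ⟪headTensor ξ hξ i w k r,
      wordProd (fun i a => freeAction ξ hξ i (π i a)) l (wordEmb ξ w.cons x)⟫_ℂ = 0 := by
    intro x
    obtain ⟨y, hy⟩ := wordProd_wordEmb ξ hξ π l hl w.cons hchain x
    obtain ⟨d, z, hz⟩ := headTensor_decomp ξ hξ i w k r
    rw [hy, hz, inner_add_left, inner_smul_left, wordEmb_orthogonal_of_length,
      wordEmb_orthogonal_of_length, mul_zero, add_zero]
    · simp; omega
    · simp; omega
  obtain hh | hw := hw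
  · obtain ⟨x, hx⟩ := headTensor_of_inner_eq_zero ξ hξ i w h hh r
    rw [hx, hcons]
  · obtain ⟨c, x, hx⟩ := headTensor_decomp ξ hξ i w h r
    rw [hx, map_add, inner_add_right, hcons, add_zero, map_smul, inner_smul_right]
    obtain ⟨⟨_, hnil⟩, hw'⟩ := w
    obtain rfl : _ = [] := hw
    have hch : (l.map Sigma.fst ++ []).IsChain (· ≠ ·) := by
      simpa using List.IsChain.left_of_append hi
    obtain ⟨y, hy⟩ := wordProd_wordEmb ξ hξ π l hl ⟨[], hnil⟩ hch r
    obtain ⟨d, z, hz⟩ := headTensor_decomp ξ hξ i ⟨⟨[], hnil⟩, hw'⟩ k r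
    rw [hy, hz, inner_add_left, inner_smul_left, wordEmb_orthogonal_of_length,
      wordEmb_orthogonal, mul_zero, add_zero, mul_zero]
    -- On the vacuum component the lengths may agree, when $l$ is a single letter; then the fact
    -- that $l$ does not end in $i$ is decisive.
    · intro e
      have e' : [i] = l.map Sigma.fst := by simpa using congrArg Subtype.val e
      rw [← e'] at hi
      simp at hi
    · simpa [eq_comm] using hne

end Moves

/-! ### Norm domination in *-algebras of pairs. -/

section Domination

variable {X : Type*} [CStarAlgebra X] {E : Type*} [NormedAddCommGroup E] [InnerProductSpace ℂ E]
  [CompleteSpace E]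

theorem norm_sq_apply_le (T : E →L[ℂ] E) (v : E) : ‖T v‖ ^ 2 ≤ ‖v‖ * ‖(star T * T) v‖ := by
  have h : ⟪v, (star T * T) v⟫_ℂ = ⟪T v, T v⟫_ℂ := by
    rw [mul_apply_eq_comp, ContinuousLinearMap.star_eq_adjoint,
      ContinuousLinearMap.adjoint_inner_right]
  calc ‖T v‖ ^ 2 = ‖⟪T v, T v⟫_ℂ‖ := by rw [inner_self_eq_norm_sq_to_K]; simp
    _ ≤ ‖v‖ * ‖(star T * T) v‖ := h ▸ norm_inner_le_norm _ _

/-- If `‖T v‖ ≤ C ‖S‖` for all `(S, T)` in a *-algebra then `‖T v‖ ≤ ‖S‖ ‖v‖`. -/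
theorem norm_snd_apply_le (P : StarSubalgebra ℂ (X × (E →L[ℂ] E))) (v : E) (C : ℝ)
    (hC : ∀ p ∈ P, ‖p.2 v‖ ≤ C * ‖p.1‖) (p) (hp : p ∈ P) : ‖p.2 v‖ ≤ ‖p.1‖ * ‖v‖ := by
  rcases eq_or_ne v 0 with rfl | hv
  · simp
  have hv' : 0 < ‖v‖ := norm_pos_iff.2 hv
  have hsa : ∀ q ∈ P, star q = q → ‖q.2 v‖ ≤ ‖q.1‖ * ‖v‖ := by
    intro q hq hqs
    have hq2 : star q.2 = q.2 := congrArg Prod.snd hqs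
    -- Iterate $\|Tv\|^2\le\|v\|\,\|T^2v\|$ for self-adjoint $T$. Since $C$ enters only once for
    -- every power, taking $2^k$-th roots removes it.
    have hpow : ∀ k : ℕ, (‖q.2 v‖ / ‖v‖) ^ (2 ^ k) ≤ ‖(q.2 ^ (2 ^ k)) v‖ / ‖v‖ := by
      intro k
      induction k with
      | zero => simp
      | succ k ih =>
        have h1 := norm_sq_apply_le (q.2 ^ (2 ^ k)) v
        rw [star_pow, hq2, ← pow_add, ← mul_two, ← pow_succ] at h1
        rw [pow_succ 2 k, pow_mul]
        calc ((‖q.2 v‖ / ‖v‖) ^ (2 ^ k)) ^ 2 ≤ (‖(q.2 ^ (2 ^ k)) v‖ / ‖v‖) ^ 2 := by gcongr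
          _ ≤ _ := by
            rw [div_pow, ← pow_succ, div_le_div_iff₀ (by positivity) hv']
            nlinarith
    have hb : ∀ k : ℕ, (‖q.2 v‖ / ‖v‖) ^ (2 ^ k) ≤ (|C| / ‖v‖) * ‖q.1‖ ^ (2 ^ k) := by
      intro k
      refine (hpow k).trans ?_
      rw [div_mul_eq_mul_div]
      gcongr
      calc ‖(q.2 ^ (2 ^ k)) v‖ ≤ C * ‖q.1 ^ (2 ^ k)‖ := hC (q ^ (2 ^ k)) (pow_mem hq _)
        _ ≤ |C| * ‖q.1‖ ^ (2 ^ k) := by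
          gcongr
          · exact le_abs_self C
          · exact norm_pow_le' _ (by positivity)
    rcases eq_or_ne ‖q.1‖ 0 with h0 | h0
    · have := hC q hq
      rw [h0, mul_zero] at this
      exact this.trans (by positivity)
    · have h0' : 0 < ‖q.1‖ := lt_of_le_of_ne (norm_nonneg _) h0.symm
      by_contra! hlt
      have h1 : 1 < ‖q.2 v‖ / ‖v‖ / ‖q.1‖ := by
        rw [one_lt_div h0', lt_div_iff₀ hv']
        exact hlt
      obtain ⟨n, hn⟩ := pow_unbounded_of_one_lt (|C| / ‖v‖) h1
      have h2 := hb n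
      rw [← div_le_iff₀ (by positivity), ← div_pow] at h2
      exact absurd (hn.trans_le ((pow_le_pow_right₀ h1.le n.lt_two_pow_self.le).trans h2))
        (lt_irrefl _)
  have h1 := hsa (star p * p) (mul_mem (star_mem hp) hp) (by rw [star_mul, star_star])
  have h2 := norm_sq_apply_le p.2 v
  have h3 : ‖(star p * p).1‖ = ‖p.1‖ * ‖p.1‖ := CStarRing.norm_star_mul_self (x := p.1)
  rw [h3] at h1
  refine abs_le_of_sq_le_sq' ?_ (by positivity) |>.2
  calc ‖p.2 v‖ ^ 2 ≤ ‖v‖ * ‖(star p.2 * p.2) v‖ := h2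
    _ ≤ ‖v‖ * (‖p.1‖ * ‖p.1‖ * ‖v‖) := by gcongr; exact h1
    _ = (‖p.1‖ * ‖v‖) ^ 2 := by ring

/-- The vectors `v` for which `‖T v‖` is dominated by `‖S‖`, `(S, T)` in a *-algebra. -/
def dominated (P : StarSubalgebra ℂ (X × (E →L[ℂ] E))) : Submodule ℂ E where
  carrier := {v | ∃ C : ℝ, ∀ p ∈ P, ‖p.2 v‖ ≤ C * ‖p.1‖}
  zero_mem' := ⟨0, fun p _ => by simp⟩
  add_mem' := by
    rintro v w ⟨C, hC⟩ ⟨D, hD⟩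
    refine ⟨C + D, fun p hp => ?_⟩
    rw [map_add, add_mul]
    exact (norm_add_le _ _).trans (add_le_add (hC p hp) (hD p hp))
  smul_mem' := by
    rintro c v ⟨C, hC⟩
    refine ⟨‖c‖ * C, fun p hp => ?_⟩
    rw [map_smul, norm_smul, mul_assoc]
    exact mul_le_mul_of_nonneg_left (hC p hp) (norm_nonneg _)

theorem mem_dominated_iff (P : StarSubalgebra ℂ (X × (E →L[ℂ] E))) (v : E) :
    v ∈ dominated P ↔ ∀ p ∈ P, ‖p.2 v‖ ≤ ‖p.1‖ * ‖v‖ :=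
  ⟨fun ⟨C, hC⟩ => norm_snd_apply_le P v C hC, fun h => ⟨‖v‖, fun p hp =>
    (h p hp).trans_eq (mul_comm _ _)⟩⟩

/-- With the constant improved to $\|v\|$, domination becomes an intersection of closed conditions
on $v$. -/
theorem isClosed_dominated (P : StarSubalgebra ℂ (X × (E →L[ℂ] E))) :
    IsClosed (dominated P : Set E) := by
  have : (dominated P : Set E) = ⋂ p ∈ P, {v | ‖p.2 v‖ ≤ ‖p.1‖ * ‖v‖} := by
    ext v
    simpa using mem_dominated_iff P v
  rw [this]
  exact isClosed_biInter fun p _ => isClosed_le (by fun_prop) (by fun_prop)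

theorem apply_mem_dominated (P : StarSubalgebra ℂ (X × (E →L[ℂ] E))) {v : E}
    (hv : v ∈ dominated P) {q} (hq : q ∈ P) : q.2 v ∈ dominated P := by
  rw [mem_dominated_iff] at hv
  refine ⟨‖q.1‖ * ‖v‖, fun p hp => ?_⟩
  calc ‖p.2 (q.2 v)‖ ≤ ‖p.1 * q.1‖ * ‖v‖ := hv (p * q) (mul_mem hp hq)
    _ ≤ ‖p.1‖ * ‖q.1‖ * ‖v‖ := by gcongr; exact norm_mul_le _ _
    _ = ‖q.1‖ * ‖v‖ * ‖p.1‖ := by ring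

/-- Apply the bound to $p^*p$: $\|Tv\|^2=\langle v,T^*Tv\rangle\le C\|S^*S\|=C\|S\|^2$. So only
diagonal matrix coefficients need to be estimated. -/
theorem mem_dominated_of_inner (P : StarSubalgebra ℂ (X × (E →L[ℂ] E))) {v : E} (C : ℝ)
    (hC : ∀ p ∈ P, ‖⟪v, p.2 v⟫_ℂ‖ ≤ C * ‖p.1‖) : v ∈ dominated P := by
  have hC0 : 0 ≤ |C| := abs_nonneg C
  refine ⟨√|C|, fun p hp => ?_⟩
  have h1 := hC (star p * p) (mul_mem (star_mem hp) hp)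
  have h2 : ⟪v, (star p * p).2 v⟫_ℂ = ⟪p.2 v, p.2 v⟫_ℂ := by
    change ⟪v, (star p.2 * p.2) v⟫_ℂ = _
    rw [mul_apply_eq_comp, ContinuousLinearMap.star_eq_adjoint,
      ContinuousLinearMap.adjoint_inner_right]
  have h3 : ‖(star p * p).1‖ = ‖p.1‖ * ‖p.1‖ := CStarRing.norm_star_mul_self (x := p.1)
  have h4 : ‖⟪p.2 v, p.2 v⟫_ℂ‖ = ‖p.2 v‖ ^ 2 := by rw [inner_self_eq_norm_sq_to_K]; simp
  rw [h2, h3, h4] at h1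
  refine abs_le_of_sq_le_sq' ?_ (by positivity) |>.2
  rw [mul_pow, Real.sq_sqrt hC0]
  nlinarith [le_abs_self C, mul_nonneg (norm_nonneg p.1) (norm_nonneg p.1)]

/-- A *-algebra of pairs `(S, T)` with `‖T‖ ≤ ‖S‖` is the graph of a *-homomorphism, which extends
to the closure. -/
theorem exists_starAlgHom_of_norm_le {Y : Type*} [CStarAlgebra Y] (P : StarSubalgebra ℂ (X × Y))
    (hP : ∀ p ∈ P, ‖p.2‖ ≤ ‖p.1‖) (B : StarSubalgebra ℂ X)
    (hB : B ≤ (P.map (StarAlgHom.fst ℂ X Y)).topologicalClosure) :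
    ∃ ρ : B →⋆ₐ[ℂ] Y, ∀ p ∈ P, ∀ b : B, (b : X) = p.1 → ρ b = p.2 := by
  set C := P.topologicalClosure
  have hC : ∀ p ∈ C, ‖p.2‖ ≤ ‖p.1‖ := fun p hp =>
    closure_minimal (s := (P : Set (X × Y))) (t := {p | ‖p.2‖ ≤ ‖p.1‖}) hP
      (isClosed_le (by fun_prop) (by fun_prop)) hp
  -- The sup norm of a pair in the closure is that of its first entry. The projection of the
  -- complete set `C` is therefore closed, and it contains `B`.
  have hiso : Isometry fun p : C => (p : X × Y).1 := by
    refine Isometry.of_dist_eq fun p q => ?_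
    have h : ‖((p : X × Y) - q).2‖ ≤ ‖((p : X × Y) - q).1‖ := hC _ (sub_mem p.2 q.2)
    rw [Subtype.dist_eq, Prod.dist_eq, dist_eq_norm, dist_eq_norm]
    exact (max_eq_left h).symm
  have hcl : IsClosed (Set.range fun p : C => (p : X × Y).1) :=
    hiso.isClosedEmbedding.isClosed_range
  have hex : ∀ b : B, ∃ y, ((b : X), y) ∈ C := by
    intro b
    have : (b : X) ∈ Set.range fun p : C => (p : X × Y).1 := by
      refine closure_minimal ?_ hcl (hB b.2)
      rintro _ ⟨p, hp, rfl⟩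
      exact ⟨⟨p, StarSubalgebra.le_topologicalClosure P hp⟩, rfl⟩
    obtain ⟨⟨⟨x, y⟩, hp⟩, rfl : x = b⟩ := this
    exact ⟨y, hp⟩
  have huniq : ∀ x y y', (x, y) ∈ C → (x, y') ∈ C → y = y' := by
    intro x y y' h h'
    have := hC _ (sub_mem h h')
    simpa [sub_eq_zero] using this
  choose r hr using hex
  have hr' : ∀ (b : B) y, ((b : X), y) ∈ C → r b = y := fun b y h => huniq _ _ _ (hr b) h
  refine ⟨{ toFun := r
            map_one' := hr' _ _ (one_mem C)
            map_mul' := fun a b => hr' _ _ (mul_mem (hr a) (hr b))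
            map_zero' := hr' _ _ (zero_mem C)
            map_add' := fun a b => hr' _ _ (add_mem (hr a) (hr b))
            commutes' := fun c => hr' _ _ (algebraMap_mem C c)
            map_star' := fun a => hr' _ _ (star_mem (hr a)) }, fun p hp b hb => ?_⟩
  refine hr' b p.2 ?_
  rw [hb]
  exact StarSubalgebra.le_topologicalClosure P hp

end Domination

/-! ### Comparison of free products with equal vector states. -/

/-- The unit vector spanning the summand of the empty word. -/
def vacuum {ι : Type u} {H : ι → Type*} [∀ i, NormedAddCommGroup (H i)]
    [∀ i, InnerProductSpace ℂ (H i)] (ξ : ∀ i, H i) : WordSpace ξ ([] : List ι) :=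
  EuclideanSpace.single PUnit.unit (1 : ℂ)

theorem norm_vacuum {ι : Type u} {H : ι → Type*} [∀ i, NormedAddCommGroup (H i)]
    [∀ i, InnerProductSpace ℂ (H i)] (ξ : ∀ i, H i) : ‖vacuum ξ‖ = 1 :=
  have h : ‖(EuclideanSpace.single PUnit.unit 1 : EuclideanSpace ℂ PUnit)‖ = 1 := by simp
  h

section Comparison

variable {ι : Type u} [DecidableEq ι] {A : ι → Type*} [∀ i, CStarAlgebra (A i)]
  {H K : ι → Type*}
  [∀ i, NormedAddCommGroup (H i)] [∀ i, InnerProductSpace ℂ (H i)] [∀ i, CompleteSpace (H i)]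
  [∀ i, NormedAddCommGroup (K i)] [∀ i, InnerProductSpace ℂ (K i)] [∀ i, CompleteSpace (K i)]
  (π : ∀ i, A i →⋆ₐ[ℂ] (H i →L[ℂ] H i)) (ξ : ∀ i, H i) (hξ : ∀ i, ‖ξ i‖ = 1)
  (σ : ∀ i, A i →⋆ₐ[ℂ] (K i →L[ℂ] K i)) (η : ∀ i, K i) (hη : ∀ i, ‖η i‖ = 1)

/-- The action of `A i` on a pair of free products. -/
def pairAction (i : ι) :
    A i →⋆ₐ[ℂ] (FreeHilbert ξ →L[ℂ] FreeHilbert ξ) × (FreeHilbert η →L[ℂ] FreeHilbert η) :=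
  ((freeAction ξ hξ i).comp (π i)).prod ((freeAction η hη i).comp (σ i))

/-- The *-algebra generated by the actions of all `A i` on a pair of free products. -/
def pairAlgebra : StarSubalgebra ℂ
    ((FreeHilbert ξ →L[ℂ] FreeHilbert ξ) × (FreeHilbert η →L[ℂ] FreeHilbert η)) :=
  StarAlgebra.adjoin ℂ (⋃ i, Set.range (pairAction π ξ hξ σ η hη i))

theorem pairAction_mem (i : ι) (a : A i) :
    pairAction π ξ hξ σ η hη i a ∈ pairAlgebra π ξ hξ σ η hη :=
  StarAlgebra.subset_adjoin ℂ _ (Set.mem_iUnion.2 ⟨i, a, rfl⟩)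

theorem pairAction_snd (i : ι) (a : A i) :
    (pairAction π ξ hξ σ η hη i a).2 = freeAction η hη i (σ i a) := rfl

/-- The vector state on `A i`. -/
def vectorFunctional {E B : Type*} [NormedAddCommGroup E] [InnerProductSpace ℂ E]
    [CompleteSpace E] [CStarAlgebra B] (π : B →⋆ₐ[ℂ] (E →L[ℂ] E)) (ξ : E) : B →ₗ[ℂ] ℂ where
  toFun a := ⟪ξ, π a ξ⟫_ℂ
  map_add' a b := by simp
  map_smul' c a := by simp

theorem vectorFunctional_one {E B : Type*} [NormedAddCommGroup E] [InnerProductSpace ℂ E]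
    [CompleteSpace E] [CStarAlgebra B] (π : B →⋆ₐ[ℂ] (E →L[ℂ] E)) (ξ : E) (hξ : ‖ξ‖ = 1) :
    vectorFunctional π ξ 1 = 1 := by
  simp [vectorFunctional, inner_self_eq_norm_sq_to_K, hξ]

theorem wordProd_pairAction (l : List (Σ i, A i)) :
    wordProd (fun i => pairAction π ξ hξ σ η hη i) l =
      (wordProd (fun i a => freeAction ξ hξ i (π i a)) l,
        wordProd (fun i a => freeAction η hη i (σ i a)) l) :=
  Prod.ext
    (map_wordProd (MonoidHom.fst _ _) (fun i => pairAction π ξ hξ σ η hη i) l)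
    (map_wordProd (MonoidHom.snd _ _) (fun i => pairAction π ξ hξ σ η hη i) l)

/-- Linear properties of the pair algebra can be checked on reduced words. -/
theorem pairAlgebra_induction {p : (FreeHilbert ξ →L[ℂ] FreeHilbert ξ) ×
      (FreeHilbert η →L[ℂ] FreeHilbert η)} (hp : p ∈ pairAlgebra π ξ hξ σ η hη)
    (Q : (FreeHilbert ξ →L[ℂ] FreeHilbert ξ) → (FreeHilbert η →L[ℂ] FreeHilbert η) → Prop)
    (hword : ∀ l : List (Σ i, A i), IsReduced (fun i a => ⟪ξ i, π i a (ξ i)⟫_ℂ) l →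
      Q (wordProd (fun i a => freeAction ξ hξ i (π i a)) l)
        (wordProd (fun i a => freeAction η hη i (σ i a)) l))
    (h0 : Q 0 0) (hadd : ∀ S T S' T', Q S T → Q S' T' → Q (S + S') (T + T'))
    (hsmul : ∀ (c : ℂ) S T, Q S T → Q (c • S) (c • T)) : Q p.1 p.2 := by
  have h := adjoin_le_span_wordProd (pairAction π ξ hξ σ η hη)
    (fun i => vectorFunctional (π i) (ξ i)) (fun i => vectorFunctional_one _ _ (hξ i)) hp
  clear hp
  induction h using Submodule.span_induction with
  | zero => exact h0
  | add x y _ _ hx hy => exact hadd _ _ _ _ hx hy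
  | smul c x _ hx => exact hsmul _ _ _ hx
  | mem x hx =>
    obtain ⟨l, hl, rfl⟩ := hx
    rw [wordProd_pairAction]
    exact hword l hl

variable (hstate : ∀ i (a : A i), ⟪η i, σ i a (η i)⟫_ℂ = ⟪ξ i, π i a (ξ i)⟫_ℂ)

include hstate

/-- Both vacuum expectations vanish on nonempty reduced words, so they agree on all pairs up to the
factor $\|x\|^2$. -/
theorem wordEmb_nil_mem_dominated (x : WordSpace η ([] : List ι)) :
    wordEmb η ⟨[], List.IsChain.nil⟩ x ∈ dominated (pairAlgebra π ξ hξ σ η hη) := by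
  refine mem_dominated_of_inner _ (‖x‖ ^ 2) fun p hp => ?_
  let Ω := wordEmb ξ (⟨[], List.IsChain.nil⟩ : Word ι) (vacuum ξ)
  have hΩ : ‖Ω‖ = 1 := by rw [LinearIsometry.norm_map, norm_vacuum]
  let y := wordEmb η (⟨[], List.IsChain.nil⟩ : Word ι) x
  have h : ⟪y, p.2 y⟫_ℂ = ((‖x‖ ^ 2 : ℝ) : ℂ) * ⟪Ω, p.1 Ω⟫_ℂ := by
    refine pairAlgebra_induction π ξ hξ σ η hη hp
      (fun S T => ⟪y, T y⟫_ℂ = ((‖x‖ ^ 2 : ℝ) : ℂ) * ⟪Ω, S Ω⟫_ℂ) (fun l hl => ?_)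
      (by simp) (fun S T S' T' h h' => ?_) (fun c S T h => ?_)
    · rcases eq_or_ne l [] with rfl | hne
      · simp [y, inner_self_eq_norm_sq_to_K, hΩ]
      · rw [inner_wordProd_vacuum ξ hξ (fun i a => π i a) l hne hl,
          inner_wordProd_vacuum η hη (fun i a => σ i a) l hne
            (by simpa only [hstate] using hl), mul_zero]
    · simp only [add_apply, inner_add_right, h, h', mul_add]
    · simp only [smul_apply, inner_smul_right, h]
      ring
  rw [h, norm_mul]
  have h1 : ‖((‖x‖ ^ 2 : ℝ) : ℂ)‖ = ‖x‖ ^ 2 := by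
    rw [Complex.norm_real, Real.norm_of_nonneg (by positivity)]
  rw [h1]
  gcongr
  calc ‖⟪Ω, p.1 Ω⟫_ℂ‖ ≤ ‖Ω‖ * ‖p.1 Ω‖ := norm_inner_le_norm _ _
    _ ≤ 1 * (‖p.1‖ * 1) := by rw [hΩ]; gcongr; exact (p.1.le_opNorm Ω).trans_eq (by rw [hΩ])
    _ = ‖p.1‖ := by ring

/-- Compressions of words to `H i` and to `K i ⊗ r` are given by the same element of `A i`. -/
theorem exists_compression {p : (FreeHilbert ξ →L[ℂ] FreeHilbert ξ) ×
      (FreeHilbert η →L[ℂ] FreeHilbert η)} (hp : p ∈ pairAlgebra π ξ hξ σ η hη) (i : ι)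
    (w : WordNot i) (r : WordSpace η w.1.1) (h : K i) (hh : ∀ a, ⟪η i, σ i a h⟫_ℂ = 0)
    (w₀ : WordNot i) (hw₀ : w₀.1.1 = []) (Ω : WordSpace ξ w₀.1.1) (hΩ : ‖Ω‖ = 1) :
    ∃ b : A i, (∀ k k' : H i, ⟪headTensor ξ hξ i w₀ k' Ω, p.1 (headTensor ξ hξ i w₀ k Ω)⟫_ℂ =
        ⟪k', π i b k⟫_ℂ) ∧
      ⟪headTensor η hη i w h r, p.2 (headTensor η hη i w h r)⟫_ℂ =
        ((‖r‖ ^ 2 : ℝ) : ℂ) * ⟪h, σ i b h⟫_ℂ := by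
  refine pairAlgebra_induction π ξ hξ σ η hη hp (fun S T => ∃ b : A i,
    (∀ k k' : H i, ⟪headTensor ξ hξ i w₀ k' Ω, S (headTensor ξ hξ i w₀ k Ω)⟫_ℂ =
        ⟪k', π i b k⟫_ℂ) ∧
      ⟪headTensor η hη i w h r, T (headTensor η hη i w h r)⟫_ℂ =
        ((‖r‖ ^ 2 : ℝ) : ℂ) * ⟪h, σ i b h⟫_ℂ) (fun l hl => ?_)
      ⟨0, by simp, by simp⟩ ?_ ?_
  · have hl' : IsReduced (fun i a => ⟪η i, σ i a (η i)⟫_ℂ) l := by simpa only [hstate] using hl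
    have e1 : ∀ k k' : H i, ⟪headTensor ξ hξ i w₀ k' Ω, headTensor ξ hξ i w₀ k Ω⟫_ℂ =
        ⟪k', k⟫_ℂ := fun k k' => by
      rw [inner_headTensor, LinearIsometry.inner_map_map, inner_self_eq_norm_sq_to_K, hΩ]
      simp
    have e2 : ∀ k : K i, ⟪headTensor η hη i w h r, headTensor η hη i w k r⟫_ℂ =
        ((‖r‖ ^ 2 : ℝ) : ℂ) * ⟪h, k⟫_ℂ := fun k => by
      rw [inner_headTensor, LinearIsometry.inner_map_map, inner_self_eq_norm_sq_to_K, mul_comm]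
      simp
    have hh1 : ∀ a, ⟪η i, σ i a h⟫_ℂ = 0 ∨ w.1.1 = [] := fun a => .inl (hh a)
    -- The element $b$ is $1$ for the empty word, $a$ for a single letter $a$ of index $i$, and $0$
    -- otherwise. A last letter of index $i$ is absorbed into $h$, since $\sigma_i(a)h$ is again
    -- orthogonal to $\eta_i$.
    obtain rfl | ⟨t, ⟨j, a⟩, rfl⟩ : l = [] ∨ ∃ t q, l = t ++ [q] := l.eq_nil_or_concat'
    · exact ⟨1, by simpa using e1, by simpa using e2 h⟩
    by_cases hj : j = i
    · subst hj
      rcases eq_or_ne t [] with rfl | hne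
      · refine ⟨a, fun k k' => ?_, ?_⟩
        · simp [freeAction_headTensor, e1]
        · simp only [List.nil_append, wordProd_cons, wordProd_nil, mul_one,
            freeAction_headTensor, e2]
      · have hch : (t.map Sigma.fst ++ [j]).IsChain (· ≠ ·) := by simpa using hl.1
        refine ⟨0, fun k k' => ?_, ?_⟩
        · rw [wordProd_append, mul_apply_eq_comp, wordProd_cons, wordProd_nil, mul_one,
            freeAction_headTensor, inner_wordProd_headTensor ξ hξ (fun i a => π i a) j t hne
              (fun p hp => hl.2 p (List.mem_append_left _ hp)) hch w₀ Ω _ _ (.inr hw₀)]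
          simp
        · rw [wordProd_append, mul_apply_eq_comp, wordProd_cons, wordProd_nil, mul_one,
            freeAction_headTensor, inner_wordProd_headTensor η hη (fun i a => σ i a) j t hne
              (fun p hp => hl'.2 p (List.mem_append_left _ hp)) hch w r _ _ (hh1 a)]
          simp
    · have hch : ((t ++ [(⟨j, a⟩ : Σ i, A i)]).map Sigma.fst ++ [i]).IsChain (· ≠ ·) := by
        rw [List.isChain_append]
        refine ⟨hl.1, List.IsChain.singleton i, ?_⟩
        simpa using hj
      refine ⟨0, fun k k' => ?_, ?_⟩
      · rw [inner_wordProd_headTensor ξ hξ (fun i a => π i a) i _ (by simp) hl.2 hch w₀ Ω _ _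
          (.inr hw₀)]
        simp
      · rw [inner_wordProd_headTensor η hη (fun i a => σ i a) i _ (by simp) hl'.2 hch w r _ _
          (by simpa using hh1 1)]
        simp
  · rintro S T S' T' ⟨b, hb, hb'⟩ ⟨c, hc, hc'⟩
    refine ⟨b + c, fun k k' => ?_, ?_⟩
    · simp only [map_add, add_apply, inner_add_right, hb, hc]
    · simp only [map_add, add_apply, inner_add_right, hb', hc', mul_add]
  · rintro c S T ⟨b, hb, hb'⟩
    refine ⟨c • b, fun k k' => ?_, ?_⟩
    · simp only [map_smul, smul_apply, inner_smul_right, hb]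
    · simp only [map_smul, smul_apply, inner_smul_right, hb']
      ring

variable (hπ : ∀ i, Function.Injective (π i))
include hπ

/-- The compression of `p.1` to $H_i\otimes\Omega$ is $\pi_i(b)$, so faithfulness gives
$\|b\|\le\|p_1\|$. The diagonal coefficient of `p.2` involves only $\sigma_i(b)$, and
$\|\sigma_i(b)\|\le\|b\|$. -/
theorem headTensor_mem_dominated_of_inner_eq_zero (i : ι) (w : WordNot i)
    (r : WordSpace η w.1.1) (h : K i) (hh : ∀ a, ⟪η i, σ i a h⟫_ℂ = 0) :
    headTensor η hη i w h r ∈ dominated (pairAlgebra π ξ hξ σ η hη) := by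
  refine mem_dominated_of_inner _ (‖r‖ ^ 2 * ‖h‖ ^ 2) fun p hp => ?_
  obtain ⟨b, hb, hb'⟩ := exists_compression π ξ hξ σ η hη hstate hp i w r h hh
    ⟨⟨[], List.IsChain.nil⟩, by simp⟩ rfl (vacuum ξ) (norm_vacuum ξ)
  have h1 : ‖b‖ ≤ ‖p.1‖ := by
    rw [← NonUnitalStarAlgHom.norm_map (π i) (hπ i) b]
    refine ContinuousLinearMap.opNorm_le_of_re_inner_le (norm_nonneg _) fun k k' hk hk' => ?_
    rw [← inner_conj_symm, ← hb]
    refine (RCLike.re_le_norm _).trans ?_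
    rw [RCLike.norm_conj]
    refine (norm_inner_le_norm _ _).trans ?_
    have hn : ∀ k : H i, ‖k‖ = 1 → ‖headTensor ξ hξ i ⟨⟨[], List.IsChain.nil⟩, by simp⟩ k
        (vacuum ξ)‖ = 1 := fun k hk => by rw [norm_headTensor, hk, norm_vacuum, one_mul]
    rw [hn k' hk', one_mul]
    exact (p.1.le_opNorm _).trans_eq (by rw [hn k hk, mul_one])
  rw [hb', norm_mul, Complex.norm_real, Real.norm_of_nonneg (by positivity), mul_assoc]
  gcongr
  calc ‖⟪h, σ i b h⟫_ℂ‖ ≤ ‖h‖ * ‖σ i b h‖ := norm_inner_le_norm _ _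
    _ ≤ ‖h‖ * (‖σ i b‖ * ‖h‖) := by gcongr; exact (σ i b).le_opNorm h
    _ ≤ ‖h‖ * (‖p.1‖ * ‖h‖) := by
      gcongr
      exact (NonUnitalStarAlgHom.norm_apply_le (σ i) b).trans h1
    _ = ‖h‖ ^ 2 * ‖p.1‖ := by ring

/-- Split $h$ along the closure of $\sigma_i(A_i)\eta_i$. On that part, $\sigma_i(a)\eta_i\otimes r$
is a letter applied to the dominated vector $r$; on its complement the preceding lemma applies. -/
theorem headTensor_mem_dominated (i : ι) (w : WordNot i) (r : WordSpace η w.1.1)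
    (hr : wordEmb η w.1 r ∈ dominated (pairAlgebra π ξ hξ σ η hη)) (h : K i) :
    headTensor η hη i w h r ∈ dominated (pairAlgebra π ξ hξ σ η hη) := by
  generalize hD : dominated (pairAlgebra π ξ hξ σ η hη) = D at hr ⊢
  generalize hLdef : (Submodule.span ℂ (Set.range fun a => σ i a (η i))).topologicalClosure = L
  have hL : L ≤ D.comap (headTensorLeft η hη i w r) := by
    have hcl : IsClosed (D : Set (FreeHilbert η)) := hD ▸ isClosed_dominated _
    rw [← hLdef]
    refine Submodule.topologicalClosure_minimal _ (Submodule.span_le.2 ?_)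
      (hcl.preimage (continuous_headTensor η hη i w r))
    rintro _ ⟨a, rfl⟩
    change headTensor η hη i w (σ i a (η i)) r ∈ D
    rw [← freeAction_wordEmb, ← pairAction_snd π ξ hξ]
    subst hD
    exact apply_mem_dominated _ hr (pairAction_mem π ξ hξ σ η hη i a)
  have : CompleteSpace L := (hLdef ▸ Submodule.isClosed_topologicalClosure _ :
    IsClosed (L : Set (K i))).completeSpace_coe
  obtain ⟨a, ha, b, hb, rfl⟩ := Submodule.exists_add_mem_mem_orthogonal (K := L) h
  have hb0 : ∀ a, ⟪σ i a (η i), b⟫_ℂ = 0 := fun a => hb _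
    (hLdef ▸ Submodule.le_topologicalClosure _ (Submodule.subset_span ⟨a, rfl⟩))
  change headTensorLeft η hη i w r (a + b) ∈ D
  rw [map_add]
  refine D.add_mem (hL ha)
    (hD ▸ headTensor_mem_dominated_of_inner_eq_zero π ξ hξ σ η hη hstate hπ i w r b fun a => ?_)
  have := hb0 (star a)
  rwa [map_star, ContinuousLinearMap.star_eq_adjoint,
    ContinuousLinearMap.adjoint_inner_left] at this

theorem dominated_pairAlgebra : dominated (pairAlgebra π ξ hξ σ η hη) = ⊤ := by
  rw [eq_top_iff]
  rintro z -
  refine mem_of_wordEmb_mem η _ (isClosed_dominated _) ?_ z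
  rintro ⟨l, hl⟩
  induction l with
  | nil => exact wordEmb_nil_mem_dominated π ξ hξ σ η hη hstate
  | cons i l ih =>
    refine wordEmb_cons_mem η (tailNot i l hl) _ (isClosed_dominated _) fun k r => ?_
    rw [← headTensor_coe η hη]
    exact headTensor_mem_dominated π ξ hξ σ η hη hstate hπ i _ r (ih _ r) k

theorem norm_snd_le_of_mem_pairAlgebra (p) (hp : p ∈ pairAlgebra π ξ hξ σ η hη) :
    ‖p.2‖ ≤ ‖p.1‖ :=
  ContinuousLinearMap.opNorm_le_bound _ (norm_nonneg _) fun v =>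
    (mem_dominated_iff _ v).1
      ((dominated_pairAlgebra π ξ hξ σ η hη hstate hπ).symm ▸ Submodule.mem_top) p hp

/-- The reduced free product acts on the free product of any representations that have the same
vector states. -/
theorem exists_reducedFreeProduct_rep :
    ∃ ρ : reducedFreeProduct π ξ hξ →⋆ₐ[ℂ] (FreeHilbert η →L[ℂ] FreeHilbert η),
      ∀ i (a : A i), ρ (incl π ξ hξ i a) = freeAction η hη i (σ i a) := by
  obtain ⟨ρ, hρ⟩ := exists_starAlgHom_of_norm_le (pairAlgebra π ξ hξ σ η hη)
    (norm_snd_le_of_mem_pairAlgebra π ξ hξ σ η hη hstate hπ) (reducedFreeProduct π ξ hξ) (by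
      refine StarSubalgebra.topologicalClosure_mono (StarAlgebra.adjoin_le ?_)
      rintro _ ⟨_, ⟨i, rfl⟩, a, rfl⟩
      exact ⟨_, pairAction_mem π ξ hξ σ η hη i a, rfl⟩)
  exact ⟨ρ, fun i a => hρ _ (pairAction_mem π ξ hξ σ η hη i a) _ rfl⟩

end Comparison

/-! ### Isometries of free products induced by the $V_i$. -/

section Functoriality

/-- The restriction of an isometry to the orthogonal complements of corresponding vectors. -/
def complMap {E F : Type*} [NormedAddCommGroup E] [InnerProductSpace ℂ E] [NormedAddCommGroup F]
    [InnerProductSpace ℂ F] (V : E →ₗᵢ[ℂ] F) {ξ : E} {η : F} (h : V ξ = η) :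
    (ℂ ∙ ξ)ᗮ →ₗᵢ[ℂ] (ℂ ∙ η)ᗮ where
  toLinearMap := V.toLinearMap.restrict fun x hx => by
    rw [Submodule.mem_orthogonal_singleton_iff_inner_right] at hx ⊢
    rw [← h]
    exact (V.inner_map_map _ _).trans hx
  norm_map' x := V.norm_map x

variable {ι : Type u} {H : ι → Type v} {K : ι → Type w}
  [∀ i, NormedAddCommGroup (H i)] [∀ i, InnerProductSpace ℂ (H i)]
  [∀ i, NormedAddCommGroup (K i)] [∀ i, InnerProductSpace ℂ (K i)]
  (V : ∀ i, H i →ₗᵢ[ℂ] K i) {ξ : ∀ i, H i} {η : ∀ i, K i} (hV : ∀ i, V i (ξ i) = η i)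

/-- The isometry between the summands of a word induced by isometries `V i`. -/
def wordMap : ∀ l : List ι, WordSpace ξ l →ₗᵢ[ℂ] WordSpace η l
  | [] => (LinearIsometryEquiv.piLpCongrLeft 2 ℂ ℂ
      (Equiv.punitEquivPUnit : PUnit.{v + 1} ≃ PUnit.{w + 1})).toLinearIsometry
  | i :: l => (wordCons η i l).toLinearIsometry.comp
      ((htmulMap (complMap (V i) (hV i)) (wordMap l)).comp
        (wordCons ξ i l).symm.toLinearIsometry)

theorem wordMap_cons (i : ι) (l : List ι) (k : (ℂ ∙ ξ i)ᗮ) (r : WordSpace ξ l) :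
    wordMap V hV (i :: l) (wordCons ξ i l (htmul k r)) =
      wordCons η i l (htmul (complMap (V i) (hV i) k) (wordMap V hV l r)) := by
  rw [← htmulMap_htmul]
  change wordCons η i l (htmulMap _ _ ((wordCons ξ i l).symm (wordCons ξ i l _))) = _
  rw [LinearIsometryEquiv.symm_apply_apply]

variable [DecidableEq ι]

theorem wordMap_orthogonal : OrthogonalFamily ℂ (fun w : Word ι => WordSpace ξ w.1)
    fun w => (wordEmb η w).comp (wordMap V hV w.1) :=
  fun _ _ h _ _ => wordEmb_orthogonal η h _ _

/-- The isometry between free product Hilbert spaces induced by isometries `V i`. -/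
def freeMap [∀ i, CompleteSpace (K i)] : FreeHilbert ξ →ₗᵢ[ℂ] FreeHilbert η :=
  (wordMap_orthogonal V hV).linearIsometry

variable [∀ i, CompleteSpace (K i)]

theorem freeMap_wordEmb (w : Word ι) (x : WordSpace ξ w.1) :
    freeMap V hV (wordEmb ξ w x) = wordEmb η w (wordMap V hV w.1 x) :=
  (wordMap_orthogonal V hV).linearIsometry_apply_single x

variable (hξ : ∀ i, ‖ξ i‖ = 1) (hη : ∀ i, ‖η i‖ = 1)

theorem freeMap_headTensor (i : ι) (w : WordNot i) (h : H i) (r : WordSpace ξ w.1.1) :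
    freeMap V hV (headTensor ξ hξ i w h r) =
      headTensor η hη i w (V i h) (wordMap V hV w.1.1 r) := by
  obtain ⟨c, k, rfl⟩ := exists_smul_add (ξ i) h
  have h1 : freeMap V hV (headTensor ξ hξ i w (ξ i) r) =
      headTensor η hη i w (V i (ξ i)) (wordMap V hV w.1.1 r) := by
    rw [headTensor_self, hV, headTensor_self, freeMap_wordEmb]
  have h2 : freeMap V hV (headTensor ξ hξ i w k r) =
      headTensor η hη i w (V i k) (wordMap V hV w.1.1 r) := by
    rw [headTensor_coe, freeMap_wordEmb]
    refine Eq.trans ?_ (headTensor_coe η hη i w (complMap (V i) (hV i) k) _).symm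
    exact congrArg _ (wordMap_cons V hV i w.1.1 k r)
  change freeMap V hV (headTensorLeft ξ hξ i w r _) = headTensorLeft η hη i w _ _
  rw [map_add, map_add, map_add, map_add, map_smul, map_smul, map_smul, map_smul]
  exact congrArg₂ (· + ·) (congrArg _ h1) h2

end Functoriality

/-- A linear condition that holds on the vectors `U_i (h ⊗ r)` holds everywhere. -/
theorem inner_eq_zero_of_headTensor {ι : Type u} {H : ι → Type v} [DecidableEq ι]
    [∀ i, NormedAddCommGroup (H i)] [∀ i, InnerProductSpace ℂ (H i)]
    {ξ : ∀ i, H i} (hξ : ∀ i, ‖ξ i‖ = 1) {E : Type*} [NormedAddCommGroup E] [InnerProductSpace ℂ E]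
    (L : FreeHilbert ξ →L[ℂ] E) (z : E) (i : ι)
    (h : ∀ w k r, ⟪z, L (headTensor ξ hξ i w k r)⟫_ℂ = 0) (v : FreeHilbert ξ) :
    ⟪z, L v⟫_ℂ = 0 :=
  Submodule.mem_orthogonal_singleton_iff_inner_right.1
    (mem_of_headTensor_mem ξ hξ i ((ℂ ∙ z)ᗮ.comap L.toLinearMap)
      ((Submodule.isClosed_orthogonal _).preimage L.continuous)
      (fun w k r => Submodule.mem_orthogonal_singleton_iff_inner_right.2 (h w k r)) v)

theorem inner_sub_eq_zero_of_compression {E F : Type*} [NormedAddCommGroup E]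
    [InnerProductSpace ℂ E] [NormedAddCommGroup F] [InnerProductSpace ℂ F] (V : E →ₗᵢ[ℂ] F)
    {T : F →L[ℂ] F} {S : E →L[ℂ] E} (hTS : ∀ h k, ⟪V h, T (V k)⟫_ℂ = ⟪h, S k⟫_ℂ) (h k : E) :
    ⟪V h, T (V k) - V (S k)⟫_ℂ = 0 := by
  rw [inner_sub_right, hTS, LinearIsometry.inner_map_map, sub_self]

/-! ### The failure of the induced isometry to intertwine a letter. -/

section Compression

variable {ι : Type u} {H : ι → Type v} {K : ι → Type w} [DecidableEq ι]
  [∀ i, NormedAddCommGroup (H i)] [∀ i, InnerProductSpace ℂ (H i)] [∀ i, CompleteSpace (H i)]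
  [∀ i, NormedAddCommGroup (K i)] [∀ i, InnerProductSpace ℂ (K i)] [∀ i, CompleteSpace (K i)]
  (V : ∀ i, H i →ₗᵢ[ℂ] K i) {ξ : ∀ i, H i} {η : ∀ i, K i} (hV : ∀ i, V i (ξ i) = η i)
  (hξ : ∀ i, ‖ξ i‖ = 1) (hη : ∀ i, ‖η i‖ = 1)

/-- The failure of `freeMap` to intertwine `T` and its compression `S`. -/
def defect (i : ι) (T : K i →L[ℂ] K i) (S : H i →L[ℂ] H i) :
    FreeHilbert ξ →L[ℂ] FreeHilbert η :=
  (freeAction η hη i T).comp (freeMap V hV).toContinuousLinearMap -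
    (freeMap V hV).toContinuousLinearMap.comp (freeAction ξ hξ i S)

theorem defect_apply (i : ι) (T : K i →L[ℂ] K i) (S : H i →L[ℂ] H i) (v : FreeHilbert ξ) :
    defect V hV hξ hη i T S v =
      freeAction η hη i T (freeMap V hV v) - freeMap V hV (freeAction ξ hξ i S v) := rfl

/-- The defect lives in the first tensor factor only, as $TV_i-V_iS$. When $S=V_i^*TV_i$, the range
of this operator is orthogonal to that of $V_i$. -/
theorem defect_headTensor (i : ι) (T : K i →L[ℂ] K i) (S : H i →L[ℂ] H i)
    (w : WordNot i) (h : H i) (r : WordSpace ξ w.1.1) :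
    defect V hV hξ hη i T S (headTensor ξ hξ i w h r) =
      headTensor η hη i w (T (V i h) - V i (S h)) (wordMap V hV w.1.1 r) := by
  rw [defect_apply, freeMap_headTensor V hV hξ hη, freeAction_headTensor, freeAction_headTensor,
    freeMap_headTensor V hV hξ hη]
  exact ((headTensorLeft η hη i w _).map_sub _ _).symm

variable {i : ι}

theorem adjoint_freeAction_inner (T : K i →L[ℂ] K i) (x y : FreeHilbert η) :
    ⟪x, freeAction η hη i T y⟫_ℂ =
      ⟪freeAction η hη i (ContinuousLinearMap.adjoint T) x, y⟫_ℂ := by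
  rw [← ContinuousLinearMap.star_eq_adjoint, map_star, ContinuousLinearMap.star_eq_adjoint,
    ContinuousLinearMap.adjoint_inner_left]

variable {T : K i →L[ℂ] K i} {S : H i →L[ℂ] H i}
  (hTS : ∀ h k, ⟪V i h, T (V i k)⟫_ℂ = ⟪h, S k⟫_ℂ)

include hTS

theorem inner_freeMap_defect (u v : FreeHilbert ξ) :
    ⟪freeMap V hV u, defect V hV hξ hη i T S v⟫_ℂ = 0 := by
  refine inner_eq_zero_of_headTensor hξ _ _ i (fun w k r => ?_) v
  rw [← inner_conj_symm]
  refine (congrArg _ (inner_eq_zero_of_headTensor hξ (freeMap V hV).toContinuousLinearMap _ i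
    (fun w' k' r' => ?_) u)).trans (map_zero _)
  rw [LinearIsometry.coe_toContinuousLinearMap, freeMap_headTensor V hV hξ hη, defect_headTensor,
    inner_headTensor, ← inner_conj_symm, inner_sub_eq_zero_of_compression (V i) hTS, map_zero, zero_mul]

/-- A word not beginning with $i$ has first factor $\eta_i=V_i\xi_i$, which lies in the range of
$V_i$. -/
theorem inner_wordEmb_defect (w : WordNot i) (x : WordSpace η w.1.1) (v : FreeHilbert ξ) :
    ⟪wordEmb η w.1 x, defect V hV hξ hη i T S v⟫_ℂ = 0 := by
  refine inner_eq_zero_of_headTensor hξ _ _ i (fun w k r => ?_) v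
  rw [defect_headTensor, ← headTensor_self η hη, inner_headTensor, ← hV,
    inner_sub_eq_zero_of_compression (V i) hTS, zero_mul]

end Compression

/-! ### Propagation of the error under the next letter. -/

section Orthogonality

variable {ι : Type u} {H : ι → Type v} {K : ι → Type w} [DecidableEq ι]
  [∀ i, NormedAddCommGroup (H i)] [∀ i, InnerProductSpace ℂ (H i)]
  [∀ i, NormedAddCommGroup (K i)] [∀ i, InnerProductSpace ℂ (K i)] [∀ i, CompleteSpace (K i)]
  (V : ∀ i, H i →ₗᵢ[ℂ] K i) {ξ : ∀ i, H i} {η : ∀ i, K i} (hV : ∀ i, V i (ξ i) = η i)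
  (hξ : ∀ i, ‖ξ i‖ = 1) (hη : ∀ i, ‖η i‖ = 1) {i : ι} {T : K i →L[ℂ] K i}

variable (hT : ⟪η i, T (η i)⟫_ℂ = 0) {y : FreeHilbert η}
  (hy : ∀ (w : WordNot i) x, ⟪wordEmb η w.cons x, y⟫_ℂ = 0)

include hT hy in
-- Move $T$ to the other side: $T^*$ is also centred, so it creates the letter $i$, and $y$ has no
-- component there.
theorem inner_wordEmb_freeAction_eq_zero (w : WordNot i) (x : WordSpace η w.1.1) :
    ⟪wordEmb η w.1 x, freeAction η hη i T y⟫_ℂ = 0 := by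
  have hT' : ⟪η i, ContinuousLinearMap.adjoint T (η i)⟫_ℂ = 0 := by
    rw [ContinuousLinearMap.adjoint_inner_right, ← inner_conj_symm, hT, map_zero]
  obtain ⟨z, hz⟩ := headTensor_of_inner_eq_zero η hη i w _ hT' x
  rw [adjoint_freeAction_inner, freeAction_wordEmb, hz, hy]

include hy hξ in
-- $T^*V_ik\otimes r$ splits into a multiple of $r$, which lies in the range of the isometry, and a
-- vector in the summand of $iw$. Both are orthogonal to $y$.
theorem inner_freeMap_freeAction_eq_zero (hyV : ∀ u, ⟪freeMap V hV u, y⟫_ℂ = 0)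
    (u : FreeHilbert ξ) : ⟪freeMap V hV u, freeAction η hη i T y⟫_ℂ = 0 := by
  rw [← inner_conj_symm]
  refine (congrArg _ (inner_eq_zero_of_headTensor hξ (freeMap V hV).toContinuousLinearMap _ i
    (fun w k r => ?_) u)).trans (map_zero _)
  rw [LinearIsometry.coe_toContinuousLinearMap, ← inner_conj_symm, adjoint_freeAction_inner,
    freeMap_headTensor V hV hξ hη, freeAction_headTensor]
  obtain ⟨c, z, hz⟩ := headTensor_decomp η hη i w (ContinuousLinearMap.adjoint T (V i k))
    (wordMap V hV w.1.1 r)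
  rw [hz, inner_add_left, inner_smul_left, hy, ← freeMap_wordEmb, hyV, mul_zero, add_zero,
    map_zero]

end Orthogonality

/-! ### Compression of reduced words. -/

section Words

variable {ι : Type u} {H : ι → Type v} {K : ι → Type w} [DecidableEq ι]
  [∀ i, NormedAddCommGroup (H i)] [∀ i, InnerProductSpace ℂ (H i)] [∀ i, CompleteSpace (H i)]
  [∀ i, NormedAddCommGroup (K i)] [∀ i, InnerProductSpace ℂ (K i)] [∀ i, CompleteSpace (K i)]
  (V : ∀ i, H i →ₗᵢ[ℂ] K i) {ξ : ∀ i, H i} {η : ∀ i, K i} (hV : ∀ i, V i (ξ i) = η i)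
  (hξ : ∀ i, ‖ξ i‖ = 1) (hη : ∀ i, ‖η i‖ = 1)
  {A : ι → Type*} (σ : ∀ i, A i → (K i →L[ℂ] K i)) (θ : ∀ i, A i → (H i →L[ℂ] H i))
  (hσθ : ∀ i a h k, ⟪V i h, σ i a (V i k)⟫_ℂ = ⟪h, θ i a k⟫_ℂ)

include hσθ

/-- Reduced words are compressed to the words in the compressed letters, up to a vector that is
orthogonal to the range of the compression and to all words with a different first letter. -/
theorem wordProd_freeMap (l : List (Σ i, A i))
    (hl : IsReduced (fun i a => ⟪η i, σ i a (η i)⟫_ℂ) l) (v : FreeHilbert ξ) :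
    ∃ y, wordProd (fun i a => freeAction η hη i (σ i a)) l (freeMap V hV v) =
        freeMap V hV (wordProd (fun i a => freeAction ξ hξ i (θ i a)) l v) + y ∧
      (∀ u, ⟪freeMap V hV u, y⟫_ℂ = 0) ∧
      ∀ w : Word ι, w.1.head? ≠ (l.map Sigma.fst).head? → ∀ x, ⟪wordEmb η w x, y⟫_ℂ = 0 := by
  induction l with
  | nil => exact ⟨0, by simp, by simp, by simp⟩
  | cons p l ih =>
    obtain ⟨y, h1, h2, h3⟩ := ih hl.tail
    have hp : ⟪η p.1, σ p.1 p.2 (η p.1)⟫_ℂ = 0 := hl.2 p List.mem_cons_self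
    have hy : ∀ (w : WordNot p.1) x, ⟪wordEmb η w.cons x, y⟫_ℂ = 0 := by
      intro w x
      refine h3 w.cons (fun h => ?_) x
      have hch := hl.1
      rw [List.map_cons, List.isChain_cons] at hch
      exact hch.1 p.1 (Option.mem_def.2 h.symm) rfl
    set v' := wordProd (fun i a => freeAction ξ hξ i (θ i a)) l v
    -- The new error is the defect of the current letter plus that letter applied to the old error.
    refine ⟨defect V hV hξ hη p.1 (σ p.1 p.2) (θ p.1 p.2) v' +
      freeAction η hη p.1 (σ p.1 p.2) y, ?_, fun u => ?_, fun w hw x => ?_⟩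
    · rw [wordProd_cons, mul_apply_eq_comp, h1, map_add, wordProd_cons, mul_apply_eq_comp,
        defect_apply]
      abel
    · rw [inner_add_right, inner_freeMap_defect V hV hξ hη (hσθ p.1 p.2),
        inner_freeMap_freeAction_eq_zero V hV hξ hη hy h2, add_zero]
    · obtain ⟨w, rfl⟩ : ∃ w' : WordNot p.1, w = w'.1 := ⟨⟨w, hw⟩, rfl⟩
      rw [inner_add_right, inner_wordEmb_defect V hV hξ hη (hσθ p.1 p.2),
        inner_wordEmb_freeAction_eq_zero hη hp hy, add_zero]

theorem inner_wordProd_freeMap (l : List (Σ i, A i))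
    (hl : IsReduced (fun i a => ⟪η i, σ i a (η i)⟫_ℂ) l) (u v : FreeHilbert ξ) :
    ⟪freeMap V hV u, wordProd (fun i a => freeAction η hη i (σ i a)) l (freeMap V hV v)⟫_ℂ =
      ⟪u, wordProd (fun i a => freeAction ξ hξ i (θ i a)) l v⟫_ℂ := by
  obtain ⟨y, h1, h2, -⟩ := wordProd_freeMap V hV hξ hη σ θ hσθ l hl v
  rw [h1, inner_add_right, h2, add_zero, LinearIsometry.inner_map_map]

end Words

/-! ### Complete positivity of compressions of *-homomorphisms. -/

section Compression

variable {E F : Type*} [NormedAddCommGroup E] [InnerProductSpace ℂ E] [CompleteSpace E]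
  [NormedAddCommGroup F] [InnerProductSpace ℂ F] [CompleteSpace F]

/-- The compression `T ↦ V* T V`. -/
def compression (V : E →L[ℂ] F) : (F →L[ℂ] F) →ₗ[ℂ] (E →L[ℂ] E) where
  toFun T := (ContinuousLinearMap.adjoint V).comp (T.comp V)
  map_add' S T := by ext; simp
  map_smul' c T := by ext; simp

theorem compression_apply (V : E →L[ℂ] F) (T : F →L[ℂ] F) :
    compression V T = (ContinuousLinearMap.adjoint V).comp (T.comp V) := rfl

theorem continuous_compression (V : E →L[ℂ] F) : Continuous (compression V) := by
  change Continuous fun T : F →L[ℂ] F => (ContinuousLinearMap.adjoint V).comp (T.comp V)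
  fun_prop

theorem inner_compression (V : E →L[ℂ] F) (T : F →L[ℂ] F) (u v : E) :
    ⟪u, compression V T v⟫_ℂ = ⟪V u, T (V v)⟫_ℂ :=
  ContinuousLinearMap.adjoint_inner_right V u (T (V v))

theorem star_compression (V : E →L[ℂ] F) (T : F →L[ℂ] F) :
    star (compression V T) = compression V (star T) := by
  simp [compression_apply, ContinuousLinearMap.star_eq_adjoint, ContinuousLinearMap.adjoint_comp,
    ContinuousLinearMap.comp_assoc]

/-- A linear map into an operator algebra that is a compression of a *-homomorphism is completely
positive. -/
def completelyPositiveOfCompression {B : Type*} [CStarAlgebra B] [PartialOrder B]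
    [StarOrderedRing B] (S : StarSubalgebra ℂ (E →L[ℂ] E)) [IsClosed (S : Set (E →L[ℂ] E))]
    (ρ : B →⋆ₐ[ℂ] (F →L[ℂ] F)) (V : E →L[ℂ] F) (Φ : B →ₗ[ℂ] S)
    (hΦ : ∀ b, (Φ b : E →L[ℂ] E) = compression V (ρ b)) : B →CP S where
  toLinearMap := Φ
  map_cstarMatrix_nonneg' k M hM := by
    obtain ⟨N, rfl⟩ := exists_star_mul_self hM
    have hstar : ∀ b, star (Φ b) = Φ (star b) := fun b => Subtype.ext <| by
      rw [hΦ, map_star, ← star_compression, ← hΦ]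
      rfl
    refine cstarMatrix_nonneg_of_forall _ ?_ fun c => ?_
    · refine CStarMatrix.ext fun i j => ?_
      rw [CStarMatrix.star_apply, CStarMatrix.map_apply, CStarMatrix.map_apply]
      refine (hstar _).trans (congrArg Φ ?_)
      rw [← CStarMatrix.star_apply, star_mul, star_star]
    · have hM : ∀ i j, (star N * N) i j = ∑ l, star (N l i) * N l j := fun i j => by
        rw [CStarMatrix.mul_apply]; rfl
      -- With these operators the quadratic form of the image matrix is $\sum_l Y_l^*Y_l$. The order
      -- on `S` is inherited, so positivity can be checked in the ambient operators.
      let Y : Fin k → (E →L[ℂ] F) := fun l => ∑ j, (ρ (N l j)).comp (V.comp (c j : E →L[ℂ] E))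
      have hsum : ((∑ i, ∑ j, star (c i) * (star N * N).map Φ i j * c j : S) : E →L[ℂ] E) =
          ∑ l, (ContinuousLinearMap.adjoint (Y l)).comp (Y l) := by
        refine ContinuousLinearMap.ext fun v => ext_inner_left ℂ fun u => ?_
        simp only [AddSubmonoidClass.coe_finsetSum, sum_apply, inner_sum,
          CStarMatrix.map_apply, hM, map_sum, Finset.mul_sum, Finset.sum_mul,
          ContinuousLinearMap.comp_apply, ContinuousLinearMap.adjoint_inner_right, Y]
        rw [Finset.sum_congr rfl fun i _ => Finset.sum_comm, Finset.sum_comm]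
        refine Finset.sum_congr rfl fun l _ => ?_
        refine Finset.sum_comm.trans ?_
        refine Finset.sum_congr rfl fun j _ => Finset.sum_congr rfl fun i _ => ?_
        change ⟪u, star (c i : E →L[ℂ] E) ((Φ (star (N l i) * N l j) : E →L[ℂ] E)
          ((c j : E →L[ℂ] E) v))⟫_ℂ = _
        rw [ContinuousLinearMap.star_eq_adjoint, ContinuousLinearMap.adjoint_inner_right, hΦ,
          inner_compression, map_mul, map_star, mul_apply_eq_comp,
          ContinuousLinearMap.star_eq_adjoint, ContinuousLinearMap.adjoint_inner_right]
      change (0 : E →L[ℂ] E) ≤ ((∑ i, ∑ j, star (c i) * (star N * N).map Φ i j * c j : S) :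
        E →L[ℂ] E)
      rw [hsum]
      exact Finset.sum_nonneg fun l _ => (ContinuousLinearMap.nonneg_iff_isPositive _).2
        (ContinuousLinearMap.isPositive_adjoint_comp_self (Y l))

end Compression

/-! ### Density of reduced words in the reduced free product. -/

section Density

variable {ι : Type u} [DecidableEq ι] {A : ι → Type*} [∀ i, CStarAlgebra (A i)]
  {H : ι → Type v}
  [∀ i, NormedAddCommGroup (H i)] [∀ i, InnerProductSpace ℂ (H i)] [∀ i, CompleteSpace (H i)]
  (π : ∀ i, A i →⋆ₐ[ℂ] (H i →L[ℂ] H i)) (ξ : ∀ i, H i) (hξ : ∀ i, ‖ξ i‖ = 1)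

theorem coe_wordProd_incl (l : List (Σ i, A i)) :
    ((wordProd (fun i => incl π ξ hξ i) l : reducedFreeProduct π ξ hξ) :
        FreeHilbert ξ →L[ℂ] FreeHilbert ξ) =
      wordProd (fun i a => freeAction ξ hξ i (π i a)) l :=
  map_wordProd (reducedFreeProduct π ξ hξ).subtype (fun i => incl π ξ hξ i) l

/-- A closed submodule of the reduced free product containing all reduced words is everything. -/
theorem mem_of_wordProd_incl_mem (M : Submodule ℂ (reducedFreeProduct π ξ hξ))
    (hM : IsClosed (M : Set (reducedFreeProduct π ξ hξ)))
    (h : ∀ l, IsReduced (fun i a => ⟪ξ i, π i a (ξ i)⟫_ℂ) l →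
      wordProd (fun i => incl π ξ hξ i) l ∈ M) (x : reducedFreeProduct π ξ hξ) : x ∈ M := by
  have hsub : ∀ y ∈ StarAlgebra.adjoin ℂ
      (⋃ i, Set.range fun a : A i => freeAction ξ hξ i (π i a)),
      y ∈ M.map (reducedFreeProduct π ξ hξ).subtype.toLinearMap := by
    intro y hy
    have h1 := adjoin_le_span_wordProd (fun i => (freeAction ξ hξ i).comp (π i))
      (fun i => vectorFunctional (π i) (ξ i)) (fun i => vectorFunctional_one _ _ (hξ i)) hy
    refine Submodule.span_le.2 ?_ h1
    rintro _ ⟨l, hl, rfl⟩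
    exact ⟨_, h l hl, coe_wordProd_incl π ξ hξ l⟩
  have hx : x ∈ closure (M : Set (reducedFreeProduct π ξ hξ)) := by
    rw [closure_subtype]
    refine closure_mono ?_ x.2
    exact fun y hy => hsub y hy
  rwa [hM.closure_eq] at hx

end Density

/-! ### Construction of $\Phi$. -/

section FreeProductOfMaps

variable {ι : Type u} [DecidableEq ι] {A A' : ι → Type*}
  [∀ i, CStarAlgebra (A i)] [∀ i, CStarAlgebra (A' i)]
  {H H' K : ι → Type*}
  [∀ i, NormedAddCommGroup (H i)] [∀ i, InnerProductSpace ℂ (H i)] [∀ i, CompleteSpace (H i)]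
  [∀ i, NormedAddCommGroup (H' i)] [∀ i, InnerProductSpace ℂ (H' i)] [∀ i, CompleteSpace (H' i)]
  [∀ i, NormedAddCommGroup (K i)] [∀ i, InnerProductSpace ℂ (K i)] [∀ i, CompleteSpace (K i)]
  (π : ∀ i, A i →⋆ₐ[ℂ] (H i →L[ℂ] H i))
  (π' : ∀ i, A' i →⋆ₐ[ℂ] (H' i →L[ℂ] H' i)) (hπ' : ∀ i, Function.Injective (π' i))
  (ξ : ∀ i, H i) (hξ : ∀ i, ‖ξ i‖ = 1) (ξ' : ∀ i, H' i) (hξ' : ∀ i, ‖ξ' i‖ = 1)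
  (φ : ∀ i, A' i → A i)
  (hφ : ∀ i, ∀ a : A' i, ⟪ξ i, π i (φ i a) (ξ i)⟫_ℂ = ⟪ξ' i, π' i a (ξ' i)⟫_ℂ)
  (σ : ∀ i, A' i →⋆ₐ[ℂ] (K i →L[ℂ] K i)) (V : ∀ i, H i →ₗᵢ[ℂ] K i)
  (hσ : ∀ i a h k, ⟪V i h, σ i a (V i k)⟫_ℂ = ⟪h, π i (φ i a) k⟫_ℂ)

include hπ' hφ hσ

/-- The free product of maps that are given by compressions of representations. -/
theorem exists_freeProduct_of_dilation :
    ∃ Φ : reducedFreeProduct π' ξ' hξ' →CP reducedFreeProduct π ξ hξ, Φ 1 = 1 ∧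
      (∀ i a, Φ (incl π' ξ' hξ' i a) = incl π ξ hξ i (φ i a)) ∧
      ∀ l, IsReduced (fun i a => ⟪ξ' i, π' i a (ξ' i)⟫_ℂ) l →
        Φ (wordProd (fun i => incl π' ξ' hξ' i) l) =
          wordProd (fun i a => incl π ξ hξ i (φ i a)) l := by
  let η : ∀ i, K i := fun i => V i (ξ i)
  have hη : ∀ i, ‖η i‖ = 1 := fun i => ((V i).norm_map _).trans (hξ i)
  have hV : ∀ i, V i (ξ i) = η i := fun i => rfl
  have hstate : ∀ i (a : A' i), ⟪η i, σ i a (η i)⟫_ℂ = ⟪ξ' i, π' i a (ξ' i)⟫_ℂ :=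
    fun i a => (hσ i a _ _).trans (hφ i a)
  obtain ⟨ρ, hρ⟩ := exists_reducedFreeProduct_rep π' ξ' hξ' σ η hη hstate hπ'
  let W : FreeHilbert ξ →L[ℂ] FreeHilbert η := (freeMap V hV).toContinuousLinearMap
  let Ψ : reducedFreeProduct π' ξ' hξ' →ₗ[ℂ] (FreeHilbert ξ →L[ℂ] FreeHilbert ξ) :=
    (compression W).comp ρ.toLinearMap
  have hΨ : ∀ x, Ψ x = compression W (ρ x) := fun x => rfl
  have hρword : ∀ l, ρ (wordProd (fun i => incl π' ξ' hξ' i) l) =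
      wordProd (fun i a => freeAction η hη i (σ i a)) l := fun l => by
    refine (map_wordProd ρ (fun i => incl π' ξ' hξ' i) l).trans ?_
    congr 1
    funext i a
    exact hρ i a
  have hword : ∀ l, IsReduced (fun i a => ⟪ξ' i, π' i a (ξ' i)⟫_ℂ) l →
      Ψ (wordProd (fun i => incl π' ξ' hξ' i) l) =
        (wordProd (fun i a => incl π ξ hξ i (φ i a)) l : reducedFreeProduct π ξ hξ) := by
    intro l hl
    have hcoe : ((wordProd (fun i a => incl π ξ hξ i (φ i a)) l : reducedFreeProduct π ξ hξ) :
        FreeHilbert ξ →L[ℂ] FreeHilbert ξ) =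
          wordProd (fun i a => freeAction ξ hξ i (π i (φ i a))) l :=
      map_wordProd (reducedFreeProduct π ξ hξ).subtype
        (fun i a => incl π ξ hξ i (φ i a)) l
    rw [hcoe, hΨ, hρword]
    refine ContinuousLinearMap.ext fun v => ext_inner_left ℂ fun u => ?_
    rw [inner_compression]
    exact inner_wordProd_freeMap V hV hξ hη (fun i a => σ i a) (fun i a => π i (φ i a)) hσ l
      (by simpa only [hstate] using hl) u v
  -- An arbitrary letter need not be centred, so the statement on reduced words does not cover it;
  -- orthogonality of the defect to the range of $W$ does.
  have hletter : ∀ i a, Ψ (incl π' ξ' hξ' i a) = incl π ξ hξ i (φ i a) := by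
    intro i a
    rw [hΨ, hρ]
    refine ContinuousLinearMap.ext fun v => ext_inner_left ℂ fun u => ?_
    rw [inner_compression]
    have h := inner_freeMap_defect V hV hξ hη (hσ i a) u v
    rw [defect_apply, inner_sub_right, LinearIsometry.inner_map_map, sub_eq_zero] at h
    exact h
  have hmem : ∀ x, Ψ x ∈ reducedFreeProduct π ξ hξ := by
    have hcont : Continuous Ψ := (continuous_compression W).comp (map_continuous ρ)
    refine mem_of_wordProd_incl_mem π' ξ' hξ'
      ((Subalgebra.toSubmodule (reducedFreeProduct π ξ hξ).toSubalgebra).comap Ψ)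
      (IsClosed.preimage hcont (StarSubalgebra.isClosed_topologicalClosure _)) fun l hl => ?_
    change Ψ _ ∈ reducedFreeProduct π ξ hξ
    rw [hword l hl]
    exact Subtype.property _
  let Φ : reducedFreeProduct π' ξ' hξ' →ₗ[ℂ] reducedFreeProduct π ξ hξ :=
    Ψ.codRestrict (Subalgebra.toSubmodule (reducedFreeProduct π ξ hξ).toSubalgebra) hmem
  refine ⟨completelyPositiveOfCompression _ ρ W Φ hΨ, ?_, fun i a => Subtype.ext (hletter i a),
    fun l hl => Subtype.ext (hword l hl)⟩
  -- Unitality is the case of the empty reduced word.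
  exact Subtype.ext (hword [] ⟨by simp, by simp⟩)

end FreeProductOfMaps

end FreeProd

end

/-! ### The theorem for finitely many unital completely positive maps. -/

theorem mainTheorem7 {n : ℕ}
    {A A' H H' : Fin n → Type*}
    [∀ i, CStarAlgebra (A i)] [∀ i, PartialOrder (A i)] [∀ i, StarOrderedRing (A i)]
    [∀ i, CStarAlgebra (A' i)] [∀ i, PartialOrder (A' i)] [∀ i, StarOrderedRing (A' i)]
    [∀ i, NormedAddCommGroup (H i)] [∀ i, InnerProductSpace ℂ (H i)] [∀ i, CompleteSpace (H i)]
    [∀ i, NormedAddCommGroup (H' i)] [∀ i, InnerProductSpace ℂ (H' i)]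
    [∀ i, CompleteSpace (H' i)]
    (π : ∀ i, A i →⋆ₐ[ℂ] (H i →L[ℂ] H i)) (hπ : ∀ i, Function.Injective (π i))
    (π' : ∀ i, A' i →⋆ₐ[ℂ] (H' i →L[ℂ] H' i)) (hπ' : ∀ i, Function.Injective (π' i))
    (ξ : ∀ i, H i) (hξ : ∀ i, ‖ξ i‖ = 1)
    (ξ' : ∀ i, H' i) (hξ' : ∀ i, ‖ξ' i‖ = 1)
    (φ : ∀ i, A' i →CP A i) (hφ_one : ∀ i, φ i 1 = 1)
    (hφ : ∀ i, ∀ a : A' i, ⟪ξ i, π i (φ i a) (ξ i)⟫_ℂ = ⟪ξ' i, π' i a (ξ' i)⟫_ℂ) :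
    ∃ Φ : FreeProd.reducedFreeProduct π' ξ' hξ' →CP FreeProd.reducedFreeProduct π ξ hξ,
      Φ 1 = 1 ∧
      (∀ i, ∀ a : A' i, Φ (FreeProd.incl π' ξ' hξ' i a) = FreeProd.incl π ξ hξ i (φ i a)) ∧
      ∀ (m : ℕ) (idx : Fin m → Fin n) (a : ∀ j, A' (idx j)), 1 ≤ m →
        (∀ j, ⟪ξ' (idx j), π' (idx j) (a j) (ξ' (idx j))⟫_ℂ = 0) →
        (∀ j k : Fin m, (k : ℕ) = j + 1 → idx j ≠ idx k) →
        Φ (List.ofFn fun j => FreeProd.incl π' ξ' hξ' (idx j) (a j)).prod =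
          (List.ofFn fun j => Φ (FreeProd.incl π' ξ' hξ' (idx j) (a j))).prod := by
  have hdil := fun i => FreeProd.exists_stinespring
    ((π i).toLinearMap.comp (φ i).toLinearMap) (by
      change π i (φ i 1) = 1
      rw [hφ_one, map_one]) (fun a => by
      change π i (φ i (star a)) = star (π i (φ i a))
      rw [← map_star, FreeProd.completelyPositive_map_star]) (fun s h => by
      have := FreeProd.completelyPositive_kernel_nonneg (φ i) (π i) (fun x : s => (x : A' i))
        (fun x => h x)
      rw [← Finset.sum_coe_sort]
      simp_rw [← Finset.sum_coe_sort s]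
      exact this)
  choose K σ V hσ using hdil
  obtain ⟨Φ, h1, hincl, hword⟩ := FreeProd.exists_freeProduct_of_dilation π π' hπ' ξ hξ ξ' hξ'
    (fun i => φ i) hφ σ V hσ
  refine ⟨Φ, h1, hincl, fun m idx a _ ha hidx => ?_⟩
  have h := hword (List.ofFn fun j => ⟨idx j, a j⟩) ⟨?_, ?_⟩
  -- Replacing each $\Phi(A_j)$ by $\varphi_{i_j}(A_j)$ identifies the right side with the word
  -- formula.
  · simp only [hincl]
    simpa [FreeProd.wordProd, List.map_ofFn, Function.comp_def] using h
  · rw [List.map_ofFn, List.isChain_ofFn]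
    exact fun j hj => hidx _ _ rfl
  · intro p hp
    obtain ⟨j, rfl⟩ := List.mem_ofFn.1 hp
    exact ha j
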